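/- Let $p$ be a prime, $N\in\mathbb Z$, $\alpha>0$, and let $B_N=\{x\in\mathbb Q_p:\ |x|_p\le p^N\}$. Let $dx$ be the Haar measure on $\mathbb Q_p$ normalized by $\int_{\mathbb Z_p}dx=1$, let $\{x\}_p$ be the fractional part of $x\in\mathbb Q_p$ (the sum of the terms with negative powers of $p$ in the canonical expansion of $x$), and $\chi(x)=\exp(2\pi i\{x\}_p)$. For $t>0$ and $x\in\mathbb Q_p$ put $$Z_\alpha(t,x)=\int_{\mathbb Q_p}\chi(\xi x)e^{-t|\xi|_p^\alpha}\,d\xi,\qquad \lambda_\alpha=\frac{p-1}{p^{\alpha+1}-1}\,p^{\alpha(1-N)},$$ $$c(t)=p^{-N}-p^{-N}(1-p^{-1})e^{\lambda_\alpha t}\sum_{n=0}^\infty\frac{(-1)^n}{n!}t^n\frac{p^{-N\alpha n}}{1-p^{-\alpha n-1}},\qquad Z_N^{(\alpha)}(t,x)=e^{\lambda_\alpha t}Z_\alpha(t,x)+c(t).$$ Let $T_N^{(\alpha)}(0)=I$ and, for $t>0$, $$(T_N^{(\alpha)}(t)\psi)(x)=\int_{B_N}Z_N^{(\alpha)}(t,x-y)\psi(y)\,dy,\qquad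 x\in B_N.$$ Then, for every $1\le q<\infty$, these integrals converge absolutely for every $\psi\in L^q(B_N)$ (complex-valued functions) and every $x\in B_N$, and the family $T_N^{(\alpha)}(t)$, $t\ge 0$, is a $C_0$-semigroup of contractions on $L^q(B_N)$; that is, each $T_N^{(\alpha)}(t)$ is a bounded linear operator on $L^q(B_N)$ of norm at most $1$, $T_N^{(\alpha)}(s+t)=T_N^{(\alpha)}(s)T_N^{(\alpha)}(t)$ for all $s,t\ge 0$, and $\|T_N^{(\alpha)}(t)\psi-\psi\|_{L^q(B_N)}\to 0$ as $t\to 0+$ for every $\psi\in L^q(B_N)$. -/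

import Mathlib

open MeasureTheory Filter Topology Metric
open scoped NNReal ENNReal

noncomputable section

namespace PadicHeat

/-- The Borel σ-algebra on the field of `p`-adic numbers. -/
instance instMeasurableSpacePadic (p : ℕ) [Fact p.Prime] : MeasurableSpace ℚ_[p] := borel _

instance instBorelSpacePadic (p : ℕ) [Fact p.Prime] : BorelSpace ℚ_[p] := ⟨rfl⟩

/-- The ball `B_N = {x ∈ ℚ_p : |x|_p ≤ p ^ N}`, `N ∈ ℤ`. -/
def pBall (p : ℕ) [Fact p.Prime] (N : ℤ) : Set ℚ_[p] := {x | ‖x‖ ≤ (p : ℝ) ^ N}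

/-- The unit ball `ℤ_p ⊆ ℚ_p` as a compact set with nonempty interior. -/
def unitBall (p : ℕ) [Fact p.Prime] : TopologicalSpace.PositiveCompacts ℚ_[p] where
  carrier := closedBall 0 1
  isCompact' := isCompact_closedBall 0 1
  interior_nonempty' :=
    ⟨0, ball_subset_interior_closedBall (mem_ball_self one_pos)⟩

/-- The Haar measure `dx` on the additive group of `ℚ_p`, normalized so that `ℤ_p` has
measure `1`. -/
def haar (p : ℕ) [Fact p.Prime] : Measure ℚ_[p] := Measure.addHaarMeasure (unitBall p)

/-- Multiplying `x` by `p ^ n` with `n = max (0, -v(x))` gives a `p`-adic integer. -/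
lemma norm_scaled_le_one (p : ℕ) [Fact p.Prime] (x : ℚ_[p]) :
    ‖(p : ℚ_[p]) ^ (-x.valuation).toNat * x‖ ≤ 1 := by
  have hp : (1 : ℝ) < p := by exact_mod_cast (Fact.out : p.Prime).one_lt
  rcases eq_or_ne x 0 with rfl | hx
  · simp
  · rw [norm_mul, norm_pow, Padic.norm_p, Padic.norm_eq_zpow_neg_valuation hx, inv_pow,
      ← zpow_natCast, ← zpow_neg, ← zpow_add₀ (by positivity)]
    apply zpow_le_one_of_nonpos₀ hp.le
    omega

/-- The fractional part `{x}_p` of a `p`-adic number: if `|x|_p = p ^ n` with `n > 0` and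
`x = p ^ (-n) (x₀ + x₁ p + x₂ p² + ⋯)` is the canonical expansion, then
`{x}_p = p ^ (-n) (x₀ + x₁ p + ⋯ + x_{n-1} p ^ (n-1))`; otherwise `{x}_p = 0`.
Here `PadicInt.appr z n` is the truncation of the expansion of `z ∈ ℤ_p` to its first
`n` digits. -/
def fractPart (p : ℕ) [Fact p.Prime] (x : ℚ_[p]) : ℚ :=
  (PadicInt.appr (⟨(p : ℚ_[p]) ^ (-x.valuation).toNat * x, norm_scaled_le_one p x⟩ : ℤ_[p])
    (-x.valuation).toNat : ℚ) / (p : ℚ) ^ (-x.valuation).toNat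

/-- The additive character `χ(x) = exp (2 π i {x}_p)` of `ℚ_p`. -/
def chi (p : ℕ) [Fact p.Prime] (x : ℚ_[p]) : ℂ :=
  Complex.exp (2 * Real.pi * Complex.I * ((fractPart p x : ℝ) : ℂ))

/-- The heat kernel on `ℚ_p`: `Z_α(t,x) = ∫_{ℚ_p} χ(ξ x) exp (-t |ξ|_p ^ α) dξ`. -/
def heatKernel (p : ℕ) [Fact p.Prime] (α t : ℝ) (x : ℚ_[p]) : ℂ :=
  ∫ ξ, chi p (ξ * x) * ((Real.exp (-t * ‖ξ‖ ^ α) : ℝ) : ℂ) ∂(haar p)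

/-- `λ_α = (p - 1) / (p ^ (α + 1) - 1) * p ^ (α (1 - N))`. -/
def lambda (p : ℕ) (N : ℤ) (α : ℝ) : ℝ :=
  ((p : ℝ) - 1) / ((p : ℝ) ^ (α + 1) - 1) * (p : ℝ) ^ (α * (1 - (N : ℝ)))

/-- `c(t) = p^{-N} - p^{-N} (1 - p^{-1}) e^{λ_α t}
  ∑_{n ≥ 0} ((-1)^n / n!) t^n p^{-N α n} / (1 - p^{-α n - 1})`. -/
def cFun (p : ℕ) (N : ℤ) (α t : ℝ) : ℝ :=
  (p : ℝ) ^ (-N) - (p : ℝ) ^ (-N) * (1 - (p : ℝ)⁻¹) * Real.exp (lambda p N α * t) *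
    ∑' n : ℕ, (-1 : ℝ) ^ n / (n.factorial : ℝ) * t ^ n *
      ((p : ℝ) ^ (-(N : ℝ) * α * (n : ℝ)) / (1 - (p : ℝ) ^ (-α * (n : ℝ) - 1)))

/-- The heat kernel on the ball `B_N`: `Z_N^{(α)}(t,x) = e^{λ_α t} Z_α(t,x) + c(t)`. -/
def ballHeatKernel (p : ℕ) [Fact p.Prime] (N : ℤ) (α t : ℝ) (x : ℚ_[p]) : ℂ :=
  ((Real.exp (lambda p N α * t) : ℝ) : ℂ) * heatKernel p α t x + ((cFun p N α t : ℝ) : ℂ)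

/-- The space `L^q(B_N)` of complex-valued functions on `B_N`, with respect to Haar measure. -/
abbrev LqBall (p : ℕ) [Fact p.Prime] (N : ℤ) (q : ℝ≥0∞) : Type :=
  Lp ℂ q ((haar p).restrict (pBall p N))

/-- A `C₀`-semigroup of contractions on a complex normed space: `T(0) = I`,
`T(s + t) = T(s) T(t)`, `T(t) f → f` as `t → 0+` for each `f`, and `‖T(t)‖ ≤ 1`. -/
structure IsC0ContractionSemigroup {E : Type*} [NormedAddCommGroup E] [NormedSpace ℂ E]
    (T : ℝ≥0 → E →L[ℂ] E) : Prop where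
  map_zero : T 0 = ContinuousLinearMap.id ℂ E
  map_add : ∀ s t : ℝ≥0, T (s + t) = (T s).comp (T t)
  tendsto_zero : ∀ f : E, Tendsto (fun t : ℝ≥0 => T t f) (𝓝[>] 0) (𝓝 f)
  contraction : ∀ t : ℝ≥0, ‖T t‖ ≤ 1

end PadicHeat

end

/-!
The proof diagonalizes the heat kernel on `B_N`. The constant `c(t)` is `p ^ (-N)` minus `e^{λ_α t}`
times the integral of `exp (-t |ξ| ^ α)` over the frequencies `|ξ| ≤ p ^ (-N)`, expanded as a power
series in `t` (`cFun_eq`). Those frequencies contribute a constant to `Z_α(t, x)` when `x ∈ B_N`, so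
on `B_N` the correction replaces this contribution by `p ^ (-N)`, the kernel of the projection onto
constants. The other frequencies are summed sphere by sphere; the integral of `χ (ξ x)` over a ball
of radius `p ^ k` is `p ^ k` times the indicator of the dual ball (`integral_chi_closedBall`).

Abel summation then gives, for `x ∈ B_N` (`ballHeatKernel_eq`),
`Z_N(t, x) = ∑ n, (a n - a (n + 1)) * p ^ (n - N) * 1_{|x| ≤ p ^ (N - n)}`,
where `a 0 = 1` and `a n = exp (-t (p ^ (α (n - N)) - λ_α))` for `n ≥ 1`. The value of `λ_α` is at
most `p ^ (α (1 - N))` (`rate_one_nonneg`), so `a` is antitone and all coefficients are nonnegative;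
they add up to `a 0 = 1`. Hence `T(t) = ∑ n, (a n - a (n + 1)) • e n` is an average of the operators
`e n` which average a function over the balls of radius `p ^ (N - n)`. These are contractions
of `L^q` by Jensen's inequality and Tonelli's theorem (`eLpNorm_average_le`), they satisfy
`e m * e n = e (min m n)` because balls are nested or disjoint (`averageOp_mul`), and they converge
strongly to the identity, by uniform continuity on the dense subspace of continuous functions
(`tendsto_averageOp`).

The rest is abstract (`isC0ContractionSemigroup_diagonalOp`): `T(t)` has eigenvalue `a n` on the
range of `e n - e (n - 1)`, and `a n` is multiplicative in `t`. So the semigroup law and the strong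
continuity at `0` hold after composition with each `e k`, where only finitely many eigenvalues
matter, and they pass to the limit `k → ∞`.
-/

namespace PadicHeat

/-! ### The additive character -/

section Character

variable {p : ℕ} [Fact p.Prime]

lemma one_lt_cast_prime : (1 : ℝ) < p := by
  exact_mod_cast (Fact.out : p.Prime).one_lt

lemma cast_prime_pos : (0 : ℝ) < p := one_pos.trans one_lt_cast_prime

lemma fractPart_eq_div (x : ℚ_[p]) : ∃ a n : ℕ, a < p ^ n ∧ fractPart p x = a / (p : ℚ) ^ n :=
  ⟨_, _, PadicInt.appr_lt _ _, rfl⟩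

lemma norm_sub_fractPart_le_one (x : ℚ_[p]) : ‖x - (fractPart p x : ℚ_[p])‖ ≤ 1 := by
  have hp0 : (p : ℚ_[p]) ≠ 0 := by exact_mod_cast (Fact.out : p.Prime).ne_zero
  set n := (-x.valuation).toNat with hn
  set z : ℤ_[p] := ⟨(p : ℚ_[p]) ^ n * x, norm_scaled_le_one p x⟩ with hz
  have h := (PadicInt.norm_le_pow_iff_mem_span_pow _ n).2 (PadicInt.appr_spec n z)
  have e : x - (fractPart p x : ℚ_[p])
      = ((p : ℚ_[p]) ^ n)⁻¹ * ((z - z.appr n : ℤ_[p]) : ℚ_[p]) := by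
    have : fractPart p x = (z.appr n : ℚ) / (p : ℚ) ^ n := rfl
    rw [this]
    push_cast
    rw [hz]
    field_simp
  rw [e, norm_mul, norm_inv, norm_pow, Padic.norm_p, PadicInt.padic_norm_e_of_padicInt]
  calc _ ≤ (((p : ℝ)⁻¹ ^ n)⁻¹) * (p : ℝ) ^ (-n : ℤ) := by gcongr
    _ = 1 := by
      have := cast_prime_pos (p := p)
      rw [zpow_neg, zpow_natCast, inv_pow]
      field_simp

/-- A rational number whose denominator is a power of `p` and which is a `p`-adic integer is an
integer. -/
lemma exists_int_of_norm_le_one {r : ℚ} {a : ℤ} {n : ℕ} (hr : r = a / (p : ℚ) ^ n)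
    (h : ‖(r : ℚ_[p])‖ ≤ 1) : ∃ m : ℤ, r = m := by
  have hp0 : (p : ℚ) ≠ 0 := by exact_mod_cast (Fact.out : p.Prime).ne_zero
  have hpos := cast_prime_pos (p := p)
  have : ‖((a : ℤ) : ℚ_[p])‖ ≤ (p : ℝ) ^ (-n : ℤ) := by
    have e : ((a : ℤ) : ℚ_[p]) = (r : ℚ_[p]) * (p : ℚ_[p]) ^ n := by
      have : (a : ℚ) = r * (p : ℚ) ^ n := by rw [hr]; field_simp
      exact_mod_cast congrArg (Rat.cast : ℚ → ℚ_[p]) this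
    rw [e, norm_mul, norm_pow, Padic.norm_p, zpow_neg, zpow_natCast, inv_pow]
    exact mul_le_of_le_one_left (by positivity) h
  rw [Padic.norm_int_le_pow_iff_dvd] at this
  obtain ⟨m, rfl⟩ := this
  exact ⟨m, by rw [hr]; push_cast; field_simp⟩

lemma chi_eq_one_of_fractPart_eq_int {x : ℚ_[p]} {m : ℤ} (h : fractPart p x = m) :
    chi p x = 1 := by
  rw [chi, h, Complex.exp_eq_one_iff]
  exact ⟨m, by push_cast; ring⟩

lemma chi_eq_one_iff {x : ℚ_[p]} : chi p x = 1 ↔ ‖x‖ ≤ 1 := by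
  obtain ⟨a, n, han, ha⟩ := fractPart_eq_div x
  have hppos : (0 : ℚ) < (p : ℚ) ^ n := by
    have := (Fact.out : p.Prime).pos
    positivity
  constructor
  · intro h
    rw [chi, Complex.exp_eq_one_iff] at h
    obtain ⟨m, hm⟩ := h
    have h2 : ((fractPart p x : ℝ) : ℂ) = ((m : ℝ) : ℂ) := by
      have : (2 * Real.pi * Complex.I : ℂ) ≠ 0 := Complex.two_pi_I_ne_zero
      apply mul_left_cancel₀ this
      rw [hm]; push_cast; ring
    have h3 : fractPart p x = m := by exact_mod_cast Complex.ofReal_injective h2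
    -- The fractional part lies in `[0, 1)`, so it can only be the integer `0`.
    have h0 : (0 : ℚ) ≤ fractPart p x := by rw [ha]; positivity
    have h1 : fractPart p x < 1 := by
      rw [ha, div_lt_one hppos]; exact_mod_cast han
    rw [h3] at h0 h1
    have hm0 : m = 0 := by
      have h0' : 0 ≤ m := by exact_mod_cast h0
      have h1' : m < 1 := by exact_mod_cast h1
      omega
    have := norm_sub_fractPart_le_one x
    rwa [h3, hm0, Int.cast_zero, Rat.cast_zero, sub_zero] at this
  · intro h
    have h1 : ‖(fractPart p x : ℚ_[p])‖ ≤ 1 := by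
      have := Padic.nonarchimedean x (-(x - (fractPart p x : ℚ_[p])))
      rw [norm_neg] at this
      have e : x + -(x - (fractPart p x : ℚ_[p])) = (fractPart p x : ℚ_[p]) := by ring
      rw [e] at this
      exact this.trans (max_le h (norm_sub_fractPart_le_one x))
    obtain ⟨m, hm⟩ := exists_int_of_norm_le_one (a := a) (n := n) (by rw [ha]; simp) h1
    exact chi_eq_one_of_fractPart_eq_int hm

lemma chi_add (x y : ℚ_[p]) : chi p (x + y) = chi p x * chi p y := by
  obtain ⟨a, n, -, ha⟩ := fractPart_eq_div x
  obtain ⟨b, m, -, hb⟩ := fractPart_eq_div y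
  obtain ⟨c, k, -, hc⟩ := fractPart_eq_div (x + y)
  have hp0 : (p : ℚ) ≠ 0 := by exact_mod_cast (Fact.out : p.Prime).ne_zero
  obtain ⟨j, hj⟩ : ∃ j : ℤ, fractPart p (x + y) - fractPart p x - fractPart p y = j := by
    refine exists_int_of_norm_le_one (p := p)
      (a := (c : ℤ) * p ^ (n + m) - a * p ^ (k + m) - b * p ^ (k + n)) (n := k + n + m) ?_ ?_
    · rw [ha, hb, hc]
      push_cast
      field_simp
      ring
    · push_cast
      have e : ((fractPart p (x + y) : ℚ_[p]) - fractPart p x - fractPart p y) =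
        (-(x + y - fractPart p (x + y)) + (x - fractPart p x)) + (y - fractPart p y) := by ring
      rw [e]
      refine (Padic.nonarchimedean _ _).trans (max_le ((Padic.nonarchimedean _ _).trans
        (max_le ?_ (norm_sub_fractPart_le_one x))) (norm_sub_fractPart_le_one y))
      rw [norm_neg]
      exact norm_sub_fractPart_le_one _
  have e : fractPart p (x + y) = fractPart p x + fractPart p y + j := by linarith
  have h1 : Complex.exp (2 * Real.pi * Complex.I * j) = 1 := by
    rw [Complex.exp_eq_one_iff]; exact ⟨j, by ring⟩
  rw [chi, chi, chi, e, ← Complex.exp_add]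
  push_cast
  rw [mul_add, Complex.exp_add, h1, mul_one, mul_add]

lemma norm_chi (x : ℚ_[p]) : ‖chi p x‖ = 1 := by
  have e : 2 * (Real.pi : ℂ) * Complex.I * ((fractPart p x : ℝ) : ℂ)
    = ((2 * Real.pi * (fractPart p x : ℝ) : ℝ) : ℂ) * Complex.I := by push_cast; ring
  rw [chi, e, Complex.norm_exp_ofReal_mul_I]

/-- The character is locally constant, being trivial on `ℤ_p`. -/
lemma continuous_chi : Continuous (chi p) := by
  rw [continuous_iff_continuousAt]
  intro x
  apply ContinuousAt.congr (f := fun _ => chi p x) continuousAt_const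
  filter_upwards [closedBall_mem_nhds x one_pos] with y hy
  rw [mem_closedBall, dist_eq_norm] at hy
  rw [← add_sub_cancel x y, chi_add, chi_eq_one_iff.2 hy, mul_one]

end Character

/-! ### Haar measure of balls and the Fourier transform of a ball -/

section Haar

variable {p : ℕ} [Fact p.Prime]

instance : (haar p).IsAddHaarMeasure := by
  unfold haar; infer_instance

lemma haar_closedBall_zero_one : haar p (closedBall 0 1) = 1 :=
  Measure.addHaarMeasure_self

lemma haar_closedBall_eq (x : ℚ_[p]) (r : ℝ) :
    haar p (closedBall x r) = haar p (closedBall 0 r) := by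
  simpa using (haar p).addHaar_closedBall_center x r

/-- A closed ball of radius `p ^ k` splits into `p` closed balls of radius `p ^ (k - 1)`. -/
lemma haar_closedBall_eq_mul (k : ℤ) :
    haar p (closedBall 0 ((p : ℝ) ^ k)) = p * haar p (closedBall 0 ((p : ℝ) ^ (k - 1))) := by
  have hpos := cast_prime_pos (p := p)
  have hp0 : (p : ℚ_[p]) ≠ 0 := by exact_mod_cast (Fact.out : p.Prime).ne_zero
  have hnorm (k : ℤ) : ‖(p : ℚ_[p]) ^ k‖ = (p : ℝ) ^ (-k) := Padic.norm_p_zpow k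
  have hunion : closedBall (0 : ℚ_[p]) ((p : ℝ) ^ k) = ⋃ i ∈ Finset.range p,
      closedBall ((i : ℚ_[p]) * (p : ℚ_[p]) ^ (-k)) ((p : ℝ) ^ (k - 1)) := by
    ext x
    simp only [Set.mem_iUnion, Finset.mem_range, mem_closedBall, dist_eq_norm, sub_zero,
      exists_prop]
    constructor
    · intro hx
      have hz : ‖(p : ℚ_[p]) ^ k * x‖ ≤ 1 := by
        rw [norm_mul, hnorm]
        calc _ ≤ (p : ℝ) ^ (-k) * (p : ℝ) ^ k := by gcongr
          _ = 1 := by rw [← zpow_add₀ hpos.ne']; simp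
      obtain ⟨i, hi, him⟩ := PadicInt.exists_mem_range ⟨(p : ℚ_[p]) ^ k * x, hz⟩
      rw [PadicInt.maximalIdeal_eq_span_p, ← pow_one (p : ℤ_[p]),
        ← PadicInt.norm_le_pow_iff_mem_span_pow, ← PadicInt.padic_norm_e_of_padicInt] at him
      push_cast at him
      refine ⟨i, hi, ?_⟩
      have e : x - (i : ℚ_[p]) * (p : ℚ_[p]) ^ (-k)
          = (p : ℚ_[p]) ^ (-k) * ((p : ℚ_[p]) ^ k * x - i) := by
        rw [mul_sub, ← mul_assoc, ← zpow_add₀ hp0]; simp; ring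
      rw [e, norm_mul, hnorm, neg_neg, sub_eq_add_neg k, zpow_add₀ hpos.ne']
      gcongr
      exact him
    · rintro ⟨i, -, hi⟩
      have e : x = (x - (i : ℚ_[p]) * (p : ℚ_[p]) ^ (-k)) + (i : ℚ_[p]) * (p : ℚ_[p]) ^ (-k) := by
        ring
      rw [e]
      refine (Padic.nonarchimedean _ _).trans (max_le (hi.trans ?_) ?_)
      · exact zpow_le_zpow_right₀ one_lt_cast_prime.le (by omega)
      · rw [norm_mul, hnorm, neg_neg]
        exact mul_le_of_le_one_left (by positivity)
          (by exact_mod_cast Padic.norm_int_le_one (p := p) i)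
  rw [hunion, measure_biUnion_finset]
  · simp [haar_closedBall_eq]
  · intro i hi j hj hij
    rw [Function.onFun, Set.disjoint_left]
    intro x hxi hxj
    apply hij
    rw [mem_closedBall, dist_eq_norm] at hxi hxj
    have h1 : ‖((i : ℤ) - (j : ℤ) : ℤ) * (p : ℚ_[p]) ^ (-k)‖ ≤ (p : ℝ) ^ (k - 1) := by
      have e : (((i : ℤ) - (j : ℤ) : ℤ) : ℚ_[p]) * (p : ℚ_[p]) ^ (-k)
        = -(x - (i : ℚ_[p]) * (p : ℚ_[p]) ^ (-k)) + (x - (j : ℚ_[p]) * (p : ℚ_[p]) ^ (-k)) := by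
        push_cast; ring
      rw [e]
      refine (Padic.nonarchimedean _ _).trans (max_le ?_ hxj)
      rwa [norm_neg]
    rw [norm_mul, hnorm, neg_neg, sub_eq_add_neg k, zpow_add₀ hpos.ne', mul_comm] at h1
    have h2 := le_of_mul_le_mul_left h1 (zpow_pos hpos k)
    have h3 := (Padic.norm_int_le_pow_iff_dvd ((i : ℤ) - j) 1).1 (by simpa using h2)
    rw [pow_one] at h3
    have hi' := Finset.mem_range.1 hi
    have hj' := Finset.mem_range.1 hj
    have := Int.eq_zero_of_abs_lt_dvd h3 (by rw [abs_lt]; omega)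
    omega
  · intro i _
    exact measurableSet_closedBall

lemma haar_closedBall (x : ℚ_[p]) (k : ℤ) :
    haar p (closedBall x ((p : ℝ) ^ k)) = ENNReal.ofReal ((p : ℝ) ^ k) := by
  have hpos := cast_prime_pos (p := p)
  have hc : (p : ℝ≥0∞) = ENNReal.ofReal (p : ℝ) := by simp
  have hp0 : (p : ℝ≥0∞) ≠ 0 := by exact_mod_cast (Fact.out : p.Prime).ne_zero
  rw [haar_closedBall_eq]
  induction k using Int.induction_on with
  | zero => simpa using haar_closedBall_zero_one
  | succ k ih =>
    rw [haar_closedBall_eq_mul, add_sub_cancel_right, ih, hc, ← ENNReal.ofReal_mul hpos.le,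
      zpow_add_one₀ hpos.ne', mul_comm]
  | pred k ih =>
    rw [haar_closedBall_eq_mul] at ih
    have : ENNReal.ofReal ((p : ℝ) ^ (-(k : ℤ)))
        = p * ENNReal.ofReal ((p : ℝ) ^ (-(k : ℤ) - 1)) := by
      rw [hc, ← ENNReal.ofReal_mul hpos.le, ← zpow_one_add₀ hpos.ne']
      congr 2; ring
    rw [this] at ih
    exact (ENNReal.mul_right_inj hp0 (ENNReal.natCast_ne_top p)).1 ih

lemma haar_real_closedBall (x : ℚ_[p]) (k : ℤ) :
    (haar p).real (closedBall x ((p : ℝ) ^ k)) = (p : ℝ) ^ k := by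
  rw [Measure.real, haar_closedBall, ENNReal.toReal_ofReal]
  exact (zpow_pos cast_prime_pos k).le

open Classical in
/-- The Fourier transform of the indicator of a ball `closedBall 0 (p ^ k)`: it is `p ^ k` times
the indicator of the dual ball. -/
noncomputable def dualBall (p : ℕ) [Fact p.Prime] (k : ℤ) (x : ℚ_[p]) : ℝ :=
  if ‖x‖ ≤ (p : ℝ) ^ (-k) then (p : ℝ) ^ k else 0

lemma integrableOn_chi_mul (k : ℤ) (x : ℚ_[p]) :
    IntegrableOn (fun ξ => chi p (ξ * x)) (closedBall 0 ((p : ℝ) ^ k)) (haar p) :=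
  (continuous_chi.comp (continuous_mul_const x)).continuousOn.integrableOn_compact
    (isCompact_closedBall _ _)

lemma integral_chi_closedBall (k : ℤ) (x : ℚ_[p]) :
    ∫ ξ in closedBall 0 ((p : ℝ) ^ k), chi p (ξ * x) ∂(haar p) = (dualBall p k x : ℂ) := by
  have hpos := cast_prime_pos (p := p)
  unfold dualBall
  split_ifs with h
  · have : Set.EqOn (fun ξ => chi p (ξ * x)) (fun _ => (1 : ℂ)) (closedBall 0 ((p : ℝ) ^ k)) := by
      intro ξ hξ
      rw [mem_closedBall, dist_zero_right] at hξ
      apply chi_eq_one_iff.2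
      rw [norm_mul]
      calc _ ≤ (p : ℝ) ^ k * (p : ℝ) ^ (-k) := by gcongr
        _ = 1 := by rw [← zpow_add₀ hpos.ne']; simp
    rw [setIntegral_congr_fun measurableSet_closedBall this, setIntegral_const,
      haar_real_closedBall]
    simp
  · -- Translating the ball by an element `a` of it multiplies the integral by `χ (a x) ≠ 1`.
    have hx : x ≠ 0 := by
      rintro rfl
      exact h (by simpa using (zpow_pos hpos _).le)
    have hp0 : (p : ℚ_[p]) ≠ 0 := by exact_mod_cast (Fact.out : p.Prime).ne_zero
    set a : ℚ_[p] := (p * x)⁻¹ with ha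
    have hak : ‖a‖ ≤ (p : ℝ) ^ k := by
      rw [Padic.norm_eq_zpow_neg_valuation hx, not_le,
        zpow_lt_zpow_iff_right₀ one_lt_cast_prime] at h
      rw [ha, norm_inv, norm_mul, Padic.norm_p, Padic.norm_eq_zpow_neg_valuation hx,
        mul_inv, inv_inv, zpow_neg, inv_inv, ← zpow_one_add₀ hpos.ne']
      exact zpow_le_zpow_right₀ one_lt_cast_prime.le (by omega)
    have hchi : chi p (a * x) ≠ 1 := by
      rw [Ne, chi_eq_one_iff, ha, mul_inv, mul_assoc, inv_mul_cancel₀ hx, mul_one, norm_inv,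
        Padic.norm_p, inv_inv, not_le]
      exact one_lt_cast_prime
    set I := ∫ ξ in closedBall 0 ((p : ℝ) ^ k), chi p (ξ * x) ∂(haar p) with hI
    have hmem (ξ : ℚ_[p]) : a + ξ ∈ closedBall (0 : ℚ_[p]) ((p : ℝ) ^ k) ↔
        ξ ∈ closedBall (0 : ℚ_[p]) ((p : ℝ) ^ k) := by
      simp only [mem_closedBall, dist_zero_right]
      constructor
      · intro h
        have := Padic.nonarchimedean (-a) (a + ξ)
        rw [neg_add_cancel_left, norm_neg] at this
        exact this.trans (max_le hak h)
      · intro h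
        exact (Padic.nonarchimedean _ _).trans (max_le hak h)
    have key : chi p (a * x) * I = I := by
      conv_rhs => rw [hI, ← integral_indicator measurableSet_closedBall,
        ← integral_add_left_eq_self _ a]
      rw [hI, ← integral_const_mul, ← integral_indicator measurableSet_closedBall]
      congr 1
      ext ξ
      by_cases hξ : ξ ∈ closedBall (0 : ℚ_[p]) ((p : ℝ) ^ k)
      · rw [Set.indicator_of_mem hξ, Set.indicator_of_mem ((hmem ξ).2 hξ), add_mul, chi_add]
      · rw [Set.indicator_of_notMem hξ, Set.indicator_of_notMem (fun h => hξ ((hmem ξ).1 h))]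
    have : (chi p (a * x) - 1) * I = 0 := by rw [sub_mul, key, one_mul, sub_self]
    simpa [sub_ne_zero.2 hchi] using this

end Haar

/-! ### Integration over spheres -/

section Spheres

variable {p : ℕ} [Fact p.Prime]

lemma norm_eq_or_norm_le {k : ℤ} {ξ : ℚ_[p]} (h : ‖ξ‖ ≤ (p : ℝ) ^ k) :
    ‖ξ‖ = (p : ℝ) ^ k ∨ ‖ξ‖ ≤ (p : ℝ) ^ (k - 1) := by
  rcases eq_or_ne ξ 0 with rfl | h0
  · right
    simpa using (zpow_pos cast_prime_pos _).le
  · rw [Padic.norm_eq_zpow_neg_valuation h0] at h ⊢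
    rw [zpow_le_zpow_iff_right₀ one_lt_cast_prime] at h
    rcases h.eq_or_lt with h | h
    · left; rw [h]
    · right
      exact zpow_le_zpow_right₀ one_lt_cast_prime.le (by omega)

lemma closedBall_eq_sphere_union (k : ℤ) : closedBall (0 : ℚ_[p]) ((p : ℝ) ^ k)
    = sphere 0 ((p : ℝ) ^ k) ∪ closedBall 0 ((p : ℝ) ^ (k - 1)) := by
  ext ξ
  simp only [mem_closedBall, dist_zero_right, Set.mem_union, mem_sphere]
  refine ⟨norm_eq_or_norm_le, ?_⟩
  rintro (h | h)
  · exact h.le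
  · exact h.trans (zpow_le_zpow_right₀ one_lt_cast_prime.le (by omega))

lemma disjoint_sphere_closedBall {k l : ℤ} (h : l < k) :
    Disjoint (sphere (0 : ℚ_[p]) ((p : ℝ) ^ k)) (closedBall 0 ((p : ℝ) ^ l)) := by
  rw [Set.disjoint_left]
  intro ξ h1 h2
  rw [mem_sphere] at h1
  rw [mem_closedBall, h1] at h2
  exact absurd h2 (not_le.2 (zpow_lt_zpow_right₀ one_lt_cast_prime h))

lemma disjoint_sphere {k l : ℤ} (h : k ≠ l) :
    Disjoint (sphere (0 : ℚ_[p]) ((p : ℝ) ^ k)) (sphere 0 ((p : ℝ) ^ l)) := by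
  rcases lt_or_gt_of_ne h with h | h
  · exact ((disjoint_sphere_closedBall h).mono_right sphere_subset_closedBall).symm
  · exact (disjoint_sphere_closedBall h).mono_right sphere_subset_closedBall

lemma setIntegral_sphere {E : Type*} [NormedAddCommGroup E] [NormedSpace ℝ E] {f : ℚ_[p] → E}
    {k : ℤ} (hf : IntegrableOn f (closedBall 0 ((p : ℝ) ^ k)) (haar p)) :
    ∫ ξ in sphere 0 ((p : ℝ) ^ k), f ξ ∂(haar p)
      = ∫ ξ in closedBall 0 ((p : ℝ) ^ k), f ξ ∂(haar p)
        - ∫ ξ in closedBall 0 ((p : ℝ) ^ (k - 1)), f ξ ∂(haar p) := by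
  have e := closedBall_eq_sphere_union (p := p) k
  rw [e, setIntegral_union (disjoint_sphere_closedBall (by omega)) measurableSet_closedBall
    (hf.mono_set (e ▸ Set.subset_union_left)) (hf.mono_set (e ▸ Set.subset_union_right))]
  simp

lemma haar_real_sphere (k : ℤ) :
    (haar p).real (sphere 0 ((p : ℝ) ^ k)) = (p : ℝ) ^ k - (p : ℝ) ^ (k - 1) := by
  have := setIntegral_sphere (p := p) (f := fun _ => (1 : ℝ)) (k := k)
    (continuousOn_const.integrableOn_compact (isCompact_closedBall _ _))
  simpa [haar_real_closedBall] using this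

lemma univ_eq_closedBall_union (M : ℤ) : (Set.univ : Set ℚ_[p])
    = closedBall 0 ((p : ℝ) ^ M) ∪ ⋃ j : ℕ, sphere 0 ((p : ℝ) ^ (j + 1 + M : ℤ)) := by
  symm
  rw [Set.eq_univ_iff_forall]
  intro ξ
  by_cases h : ‖ξ‖ ≤ (p : ℝ) ^ M
  · left; simpa using h
  · right
    have h0 : ξ ≠ 0 := by
      rintro rfl
      exact h (by simpa using (zpow_pos cast_prime_pos _).le)
    rw [Padic.norm_eq_zpow_neg_valuation h0, zpow_le_zpow_iff_right₀ one_lt_cast_prime] at h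
    rw [Set.mem_iUnion]
    refine ⟨(-ξ.valuation - 1 - M).toNat, ?_⟩
    rw [mem_sphere, dist_zero_right, Padic.norm_eq_zpow_neg_valuation h0]
    congr 1
    omega

lemma closedBall_ae_eq_iUnion_sphere (M : ℤ) : closedBall (0 : ℚ_[p]) ((p : ℝ) ^ M)
    =ᵐ[haar p] (⋃ j : ℕ, sphere 0 ((p : ℝ) ^ (M - j : ℤ)) : Set ℚ_[p]) := by
  -- The two sets differ by the null set `{0}`.
  have h0 : ∀ᵐ ξ ∂(haar p), ξ ≠ 0 := by
    rw [ae_iff]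
    simp
  filter_upwards [h0] with ξ hξ
  apply propext
  change ξ ∈ closedBall (0 : ℚ_[p]) _ ↔ ξ ∈ (⋃ j : ℕ, sphere (0 : ℚ_[p]) _)
  rw [mem_closedBall, dist_zero_right, Set.mem_iUnion]
  simp only [mem_sphere, dist_zero_right]
  rw [Padic.norm_eq_zpow_neg_valuation hξ]
  constructor
  · intro h
    rw [zpow_le_zpow_iff_right₀ one_lt_cast_prime] at h
    exact ⟨(M + ξ.valuation).toNat, by congr 1; omega⟩
  · rintro ⟨j, hj⟩
    rw [hj]
    exact zpow_le_zpow_right₀ one_lt_cast_prime.le (by omega)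

lemma integrableOn_norm_rpow (M : ℤ) {s : ℝ} (hs : 0 ≤ s) :
    IntegrableOn (fun ξ : ℚ_[p] => ‖ξ‖ ^ s) (closedBall 0 ((p : ℝ) ^ M)) (haar p) :=
  (continuous_norm.rpow_const fun _ => Or.inr hs).continuousOn.integrableOn_compact
    (isCompact_closedBall _ _)

/-- The integral of `|ξ| ^ s` over a ball: a geometric series over the spheres in the ball. -/
lemma integral_norm_rpow (M : ℤ) {s : ℝ} (hs : 0 ≤ s) :
    ∫ ξ in closedBall (0 : ℚ_[p]) ((p : ℝ) ^ M), ‖ξ‖ ^ s ∂(haar p)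
      = (p : ℝ) ^ M * (1 - (p : ℝ)⁻¹) * ((p : ℝ) ^ (M * s) / (1 - (p : ℝ) ^ (-s - 1))) := by
  have hpos := cast_prime_pos (p := p)
  rw [setIntegral_congr_set (closedBall_ae_eq_iUnion_sphere M)]
  have hint : IntegrableOn (fun ξ : ℚ_[p] => ‖ξ‖ ^ s)
      (⋃ j : ℕ, sphere 0 ((p : ℝ) ^ (M - j : ℤ))) (haar p) :=
    (integrableOn_norm_rpow M hs).congr_set_ae (closedBall_ae_eq_iUnion_sphere M).symm
  have h1 := hasSum_integral_iUnion
    (fun j : ℕ => (isClosed_sphere (x := (0 : ℚ_[p])) (ε := (p : ℝ) ^ (M - j : ℤ))).measurableSet)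
    (fun i j hij => disjoint_sphere (by simpa using hij)) hint
  have hterm (j : ℕ) : ∫ ξ in sphere (0 : ℚ_[p]) ((p : ℝ) ^ (M - j : ℤ)), ‖ξ‖ ^ s ∂(haar p)
      = (p : ℝ) ^ M * (1 - (p : ℝ)⁻¹) * (p : ℝ) ^ (M * s) * ((p : ℝ) ^ (-s - 1)) ^ j := by
    rw [setIntegral_congr_fun (g := fun _ => ((p : ℝ) ^ (M - j : ℤ)) ^ s)
      isClosed_sphere.measurableSet, setIntegral_const, haar_real_sphere, smul_eq_mul]
    · have e1 : ((p : ℝ) ^ (M - j : ℤ)) ^ s = (p : ℝ) ^ (M * s) * (p : ℝ) ^ (-s * j) := by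
        rw [← Real.rpow_intCast, ← Real.rpow_mul hpos.le, ← Real.rpow_add hpos]
        push_cast; ring_nf
      have e2 : ((p : ℝ) ^ (-s - 1)) ^ j = (p : ℝ) ^ (-s * j) * (p : ℝ) ^ (-j : ℤ) := by
        rw [← Real.rpow_natCast, ← Real.rpow_mul hpos.le, ← Real.rpow_intCast,
          ← Real.rpow_add hpos]
        push_cast; ring_nf
      have e3 : (p : ℝ) ^ (M - j : ℤ) = (p : ℝ) ^ M * (p : ℝ) ^ (-j : ℤ) := by
        rw [sub_eq_add_neg, zpow_add₀ hpos.ne']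
      rw [e1, e2, zpow_sub_one₀ hpos.ne', e3]
      ring
    · intro ξ hξ
      rw [mem_sphere, dist_zero_right] at hξ
      simp only [hξ]
  simp_rw [hterm] at h1
  have hr : (p : ℝ) ^ (-s - 1) < 1 :=
    Real.rpow_lt_one_of_one_lt_of_neg one_lt_cast_prime (by linarith)
  rw [h1.unique ((hasSum_geometric_of_lt_one (by positivity) hr).mul_left _)]
  ring

end Spheres

/-! ### Eigenvalues of the semigroup -/

section Decay

variable {p : ℕ}

/-- The eigenvalues of the generator (up to sign): `0` on constants, and `|ξ| ^ α - λ_α` at the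
frequencies `|ξ| = p ^ (n - N)`, `n ≥ 1`. -/
noncomputable def rate (p : ℕ) (N : ℤ) (α : ℝ) : ℕ → ℝ
  | 0 => 0
  | n + 1 => ((p : ℝ) ^ (n + 1 - N : ℤ)) ^ α - lambda p N α

/-- The eigenvalue `exp (-t μ_n)` of the heat semigroup at the frequencies `|ξ| = p ^ (n - N)`. -/
noncomputable def decay (p : ℕ) (N : ℤ) (α t : ℝ) (n : ℕ) : ℝ := Real.exp (-t * rate p N α n)

/-- The weights of the averaging operators in the heat semigroup. -/
noncomputable def weight (p : ℕ) (N : ℤ) (α t : ℝ) (n : ℕ) : ℝ :=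
  decay p N α t n - decay p N α t (n + 1)

lemma decay_zero (N : ℤ) (α t : ℝ) : decay p N α t 0 = 1 := by simp [decay, rate]

lemma decay_nonneg (N : ℤ) (α t : ℝ) (n : ℕ) : 0 ≤ decay p N α t n := (Real.exp_pos _).le

lemma decay_add (N : ℤ) (α s t : ℝ) (n : ℕ) :
    decay p N α (s + t) n = decay p N α s n * decay p N α t n := by
  rw [decay, decay, decay, ← Real.exp_add]
  ring_nf

lemma decay_succ (N : ℤ) (α t : ℝ) (n : ℕ) : decay p N α t (n + 1) =
    Real.exp (lambda p N α * t) * Real.exp (-t * ((p : ℝ) ^ (n + 1 - N : ℤ)) ^ α) := by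
  rw [decay, rate, ← Real.exp_add]
  ring_nf

end Decay

/-! ### The heat kernel on a ball as a series of indicators of balls -/

section Kernel

variable {p : ℕ} [Fact p.Prime]

/-- The exponential series, integrated termwise over a ball. -/
lemma integral_exp_closedBall (M : ℤ) {α t : ℝ} (hα : 0 < α) (ht : 0 < t) :
    ∫ ξ in closedBall (0 : ℚ_[p]) ((p : ℝ) ^ M), Real.exp (-t * ‖ξ‖ ^ α) ∂(haar p)
      = (p : ℝ) ^ M * (1 - (p : ℝ)⁻¹) * ∑' n : ℕ, (-1 : ℝ) ^ n / (n.factorial : ℝ) * t ^ n *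
        ((p : ℝ) ^ ((M : ℝ) * α * (n : ℝ)) / (1 - (p : ℝ) ^ (-α * (n : ℝ) - 1))) := by
  have hpos := cast_prime_pos (p := p)
  have hnn (n : ℕ) : 0 ≤ α * n := by positivity
  have hF (n : ℕ) (ξ : ℚ_[p]) : (-t * ‖ξ‖ ^ α) ^ n / (n.factorial : ℝ)
      = ((-1) ^ n / (n.factorial : ℝ) * t ^ n) * ‖ξ‖ ^ (α * n) := by
    rw [mul_pow, ← Real.rpow_natCast (‖ξ‖ ^ α), ← Real.rpow_mul (norm_nonneg _), neg_pow]
    ring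
  have hInt (n : ℕ) : Integrable (fun ξ : ℚ_[p] => (-t * ‖ξ‖ ^ α) ^ n / (n.factorial : ℝ))
      ((haar p).restrict (closedBall 0 ((p : ℝ) ^ M))) := by
    simp_rw [hF]
    exact (integrableOn_norm_rpow M (hnn n)).const_mul _
  have hsum := hasSum_integral_of_summable_integral_norm hInt (by
    refine Summable.of_nonneg_of_le (fun n => integral_nonneg fun _ => norm_nonneg _)
      (f := fun n : ℕ => (p : ℝ) ^ M * ((t * ((p : ℝ) ^ M) ^ α) ^ n / (n.factorial : ℝ))) ?_
      ((Real.summable_pow_div_factorial _).mul_left _)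
    intro n
    have hle := norm_setIntegral_le_of_norm_le_const (μ := haar p)
      (s := closedBall (0 : ℚ_[p]) ((p : ℝ) ^ M))
      (f := fun ξ => ‖(-t * ‖ξ‖ ^ α) ^ n / (n.factorial : ℝ)‖)
      (C := (t * ((p : ℝ) ^ M) ^ α) ^ n / (n.factorial : ℝ))
      (by rw [haar_closedBall]; exact ENNReal.ofReal_lt_top) (by
        intro ξ hξ
        rw [mem_closedBall, dist_zero_right] at hξ
        rw [norm_norm, norm_div, norm_pow, norm_mul, norm_neg, Real.norm_of_nonneg ht.le,
          Real.norm_of_nonneg (by positivity : 0 ≤ ‖ξ‖ ^ α), RCLike.norm_natCast]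
        gcongr)
    rw [haar_real_closedBall, mul_comm] at hle
    exact (le_abs_self _).trans hle)
  have hexp (ξ : ℚ_[p]) : ∑' n : ℕ, (-t * ‖ξ‖ ^ α) ^ n / (n.factorial : ℝ)
      = Real.exp (-t * ‖ξ‖ ^ α) := by
    rw [Real.exp_eq_exp_ℝ, NormedSpace.exp_eq_tsum_div]
  simp_rw [hexp, hF] at hsum
  rw [← hsum.tsum_eq, ← tsum_mul_left]
  congr 1
  ext n
  rw [integral_const_mul, integral_norm_rpow M (hnn n)]
  rw [show (M : ℝ) * (α * n) = M * α * n by ring, show -(α * n) - 1 = -α * n - 1 by ring]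
  ring

/-- The function `c` corrects the contribution of the small frequencies `|ξ| ≤ p ^ (-N)`. -/
lemma cFun_eq (N : ℤ) {α t : ℝ} (hα : 0 < α) (ht : 0 < t) :
    cFun p N α t = (p : ℝ) ^ (-N) - Real.exp (lambda p N α * t) *
      ∫ ξ in closedBall (0 : ℚ_[p]) ((p : ℝ) ^ (-N)), Real.exp (-t * ‖ξ‖ ^ α) ∂(haar p) := by
  rw [integral_exp_closedBall _ hα ht, cFun]
  push_cast
  ring

lemma summable_exp_mul_zpow (M : ℤ) {α t : ℝ} (hα : 0 < α) (ht : 0 < t) :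
    Summable fun j : ℕ =>
      Real.exp (-t * ((p : ℝ) ^ (j + M : ℤ)) ^ α) * (p : ℝ) ^ (j + M : ℤ) := by
  have hpos := cast_prime_pos (p := p)
  have hp1 := one_lt_cast_prime (p := p)
  have hzp (j : ℕ) : (p : ℝ) ^ (j + M : ℤ) = (p : ℝ) ^ M * (p : ℝ) ^ j := by
    rw [zpow_add₀ hpos.ne', zpow_natCast, mul_comm]
  have hlim : Tendsto (fun j : ℕ => (p : ℝ) ^ (j + M : ℤ)) atTop atTop := by
    simp_rw [hzp]
    exact (tendsto_pow_atTop_atTop_of_one_lt hp1).const_mul_atTop (zpow_pos hpos _)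
  have ho := ((isLittleO_exp_neg_mul_rpow_atTop ht (-2 / α)).comp_tendsto
    ((tendsto_rpow_atTop hα).comp hlim)).isBigO
  have hO := ho.mul (Asymptotics.isBigO_refl (fun j : ℕ => (p : ℝ) ^ (j + M : ℤ)) atTop)
  refine summable_of_isBigO_nat (g := fun j : ℕ => ((p : ℝ) ^ M)⁻¹ * ((p : ℝ)⁻¹) ^ j) ?_ ?_
  · exact (summable_geometric_of_lt_one (by positivity) (inv_lt_one_of_one_lt₀ hp1)).mul_left _
  · refine hO.congr (fun j => rfl) fun j => ?_
    have hx : 0 < (p : ℝ) ^ (j + M : ℤ) := zpow_pos hpos _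
    simp only [Function.comp]
    rw [← Real.rpow_mul hx.le, mul_div_cancel₀ _ hα.ne']
    rw [show (-2 : ℝ) = ((-2 : ℤ) : ℝ) by norm_num, Real.rpow_intCast, ← zpow_add_one₀ hx.ne',
      show (-2 : ℤ) + 1 = -1 by norm_num, zpow_neg_one, hzp, mul_inv, inv_pow]

lemma dualBall_nonneg (k : ℤ) (x : ℚ_[p]) : 0 ≤ dualBall p k x := by
  unfold dualBall
  split_ifs
  · exact (zpow_pos cast_prime_pos _).le
  · exact le_rfl

lemma dualBall_le (k : ℤ) (x : ℚ_[p]) : dualBall p k x ≤ (p : ℝ) ^ k := by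
  unfold dualBall
  split_ifs
  · exact le_rfl
  · exact (zpow_pos cast_prime_pos _).le

/-- The heat kernel on `ℚ_p`: the small frequencies `|ξ| ≤ p ^ M` contribute a constant on the dual
ball, and the others are summed sphere by sphere. -/
lemma heatKernel_eq (M : ℤ) {α t : ℝ} (hα : 0 < α) (ht : 0 < t) {x : ℚ_[p]}
    (hx : ‖x‖ ≤ (p : ℝ) ^ (-M)) :
    heatKernel p α t x =
      ((∫ ξ in closedBall (0 : ℚ_[p]) ((p : ℝ) ^ M), Real.exp (-t * ‖ξ‖ ^ α) ∂(haar p) : ℝ) : ℂ)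
      + ((∑' j : ℕ, Real.exp (-t * ((p : ℝ) ^ (j + 1 + M : ℤ)) ^ α) *
        (dualBall p (j + 1 + M) x - dualBall p (j + M) x) : ℝ) : ℂ) := by
  have hpos := cast_prime_pos (p := p)
  set f : ℚ_[p] → ℂ := fun ξ => chi p (ξ * x) * ((Real.exp (-t * ‖ξ‖ ^ α) : ℝ) : ℂ) with hf
  have hcont : Continuous f := by
    have h1 : Continuous fun ξ : ℚ_[p] => ‖ξ‖ ^ α :=
      continuous_norm.rpow_const fun _ => Or.inr hα.le
    exact (continuous_chi.comp (continuous_mul_const x)).mul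
      (Complex.continuous_ofReal.comp (Real.continuous_exp.comp (h1.const_mul _)))
  have hball (k : ℤ) : IntegrableOn f (closedBall 0 ((p : ℝ) ^ k)) (haar p) :=
    hcont.continuousOn.integrableOn_compact (isCompact_closedBall _ _)
  have hsph (k : ℤ) : IntegrableOn f (sphere 0 ((p : ℝ) ^ k)) (haar p) :=
    (hball k).mono_set sphere_subset_closedBall
  have hnorm (ξ : ℚ_[p]) : ‖f ξ‖ = Real.exp (-t * ‖ξ‖ ^ α) := by
    rw [hf]
    simp only [norm_mul, norm_chi, one_mul, Complex.norm_real, Real.norm_eq_abs, Real.abs_exp]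
  have hunion : IntegrableOn f (⋃ j : ℕ, sphere 0 ((p : ℝ) ^ (j + 1 + M : ℤ))) (haar p) := by
    refine integrableOn_iUnion_of_summable_integral_norm (fun j => hsph _) ?_
    refine Summable.of_nonneg_of_le (fun n => integral_nonneg fun _ => norm_nonneg _) (fun j => ?_)
      ((summable_exp_mul_zpow (p := p) (1 + M) hα ht))
    rw [setIntegral_congr_fun
      (g := fun _ => Real.exp (-t * ((p : ℝ) ^ (j + 1 + M : ℤ)) ^ α))
      isClosed_sphere.measurableSet, setIntegral_const, haar_real_sphere, smul_eq_mul, mul_comm,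
      ← add_assoc]
    · gcongr
      linarith [zpow_pos hpos (j + 1 + M - 1)]
    · intro ξ hξ
      rw [mem_sphere, dist_zero_right] at hξ
      simp only [hnorm, hξ]
  have hdisj : Disjoint (closedBall (0 : ℚ_[p]) ((p : ℝ) ^ M))
      (⋃ j : ℕ, sphere 0 ((p : ℝ) ^ (j + 1 + M : ℤ))) := by
    rw [Set.disjoint_iUnion_right]
    exact fun j => (disjoint_sphere_closedBall (by omega)).symm
  have hmeas (k : ℤ) : MeasurableSet (sphere (0 : ℚ_[p]) ((p : ℝ) ^ k)) :=
    isClosed_sphere.measurableSet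
  change ∫ ξ, f ξ ∂(haar p) = _
  rw [← setIntegral_univ, univ_eq_closedBall_union M,
    setIntegral_union hdisj (MeasurableSet.iUnion fun j => hmeas _) (hball M) hunion]
  congr 1
  · rw [← integral_complex_ofReal]
    refine setIntegral_congr_fun measurableSet_closedBall fun ξ hξ => ?_
    rw [mem_closedBall, dist_zero_right] at hξ
    have : chi p (ξ * x) = 1 := by
      rw [chi_eq_one_iff, norm_mul]
      calc _ ≤ (p : ℝ) ^ M * (p : ℝ) ^ (-M) := by gcongr
        _ = 1 := by rw [← zpow_add₀ hpos.ne']; simp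
    rw [hf]
    simp only [this, one_mul]
  · have h1 := hasSum_integral_iUnion (fun j : ℕ => hmeas (j + 1 + M))
      (fun i j hij => disjoint_sphere (by simpa using hij)) hunion
    rw [← h1.tsum_eq, Complex.ofReal_tsum]
    congr 1
    ext j
    rw [setIntegral_congr_fun (g := fun ξ =>
      ((Real.exp (-t * ((p : ℝ) ^ (j + 1 + M : ℤ)) ^ α) : ℝ) : ℂ) * chi p (ξ * x)) (hmeas _),
      integral_const_mul, setIntegral_sphere (integrableOn_chi_mul _ _),
      integral_chi_closedBall, integral_chi_closedBall,
      show (j : ℤ) + 1 + M - 1 = j + M by ring]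
    · push_cast; rfl
    · intro ξ hξ
      rw [mem_sphere, dist_zero_right] at hξ
      simp only [hf, hξ]
      ring

lemma rate_one_nonneg (N : ℤ) {α : ℝ} (hα : 0 < α) : 0 ≤ rate p N α 1 := by
  have hpos := cast_prime_pos (p := p)
  have hp1 := one_lt_cast_prime (p := p)
  have e : ((p : ℝ) ^ (((0 : ℕ) : ℤ) + 1 - N : ℤ)) ^ α = (p : ℝ) ^ (α * (1 - (N : ℝ))) := by
    rw [← Real.rpow_intCast, ← Real.rpow_mul hpos.le]
    push_cast
    ring_nf
  have hlt : (p : ℝ) < (p : ℝ) ^ (α + 1) := by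
    conv_lhs => rw [← Real.rpow_one (p : ℝ)]
    exact Real.rpow_lt_rpow_of_exponent_lt hp1 (by linarith)
  rw [rate, e, lambda, sub_nonneg]
  apply mul_le_of_le_one_left (by positivity)
  rw [div_le_one (by linarith)]
  linarith

lemma monotone_rate (N : ℤ) {α : ℝ} (hα : 0 < α) : Monotone (rate p N α) := by
  refine monotone_nat_of_le_succ fun n => ?_
  rcases n with _ | n
  · exact rate_one_nonneg N hα
  · rw [rate, rate]
    gcongr
    · exact one_lt_cast_prime.le
    · omega

lemma antitone_decay (N : ℤ) {α t : ℝ} (hα : 0 < α) (ht : 0 ≤ t) : Antitone (decay p N α t) := by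
  intro m n h
  unfold decay
  have := mul_le_mul_of_nonneg_left (monotone_rate (p := p) N hα h) ht
  exact Real.exp_le_exp.2 (by linarith)

lemma summable_decay_mul_zpow (N : ℤ) {α t : ℝ} (hα : 0 < α) (ht : 0 < t) :
    Summable fun n : ℕ => decay p N α t n * (p : ℝ) ^ (n - N : ℤ) := by
  rw [← summable_nat_add_iff 1]
  refine ((summable_exp_mul_zpow (p := p) (1 - N) hα ht).mul_left
    (Real.exp (lambda p N α * t))).congr fun n => ?_
  rw [decay_succ]
  push_cast
  rw [add_sub_assoc, mul_assoc]

lemma tendsto_decay (N : ℤ) {α t : ℝ} (hα : 0 < α) (ht : 0 < t) :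
    Tendsto (decay p N α t) atTop (𝓝 0) := by
  have hpos := cast_prime_pos (p := p)
  have h := ((summable_decay_mul_zpow (p := p) N hα ht).tendsto_atTop_zero).const_mul
    ((p : ℝ) ^ N)
  rw [mul_zero] at h
  refine squeeze_zero (fun n => decay_nonneg N α t n) (fun n => ?_) h
  have e : (p : ℝ) ^ N * (decay p N α t n * (p : ℝ) ^ (n - N : ℤ))
      = decay p N α t n * (p : ℝ) ^ n := by
    rw [zpow_sub₀ hpos.ne', zpow_natCast]
    have := (zpow_pos hpos N).ne'
    field_simp
  rw [e]
  exact le_mul_of_one_le_right (decay_nonneg _ _ _ _) (one_le_pow₀ one_lt_cast_prime.le)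

lemma weight_nonneg (N : ℤ) {α t : ℝ} (hα : 0 < α) (ht : 0 ≤ t) (n : ℕ) :
    0 ≤ weight p N α t n :=
  sub_nonneg.2 (antitone_decay N hα ht n.le_succ)

lemma hasSum_weight_add (N : ℤ) {α t : ℝ} (hα : 0 < α) (ht : 0 < t) (k : ℕ) :
    HasSum (fun n => weight p N α t (n + k)) (decay p N α t k) := by
  rw [hasSum_iff_tendsto_nat_of_nonneg (fun n => weight_nonneg N hα ht.le _)]
  have e (n : ℕ) : ∑ i ∈ Finset.range n, weight p N α t (i + k)
      = decay p N α t k - decay p N α t (n + k) := by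
    have := Finset.sum_range_sub' (fun i => decay p N α t (i + k)) n
    simp only [zero_add] at this
    rw [← this]
    refine Finset.sum_congr rfl fun i _ => ?_
    rw [weight, add_right_comm]
  simp_rw [e]
  have := ((tendsto_add_atTop_iff_nat k).2 (tendsto_decay (p := p) N hα ht)).const_sub
    (decay p N α t k)
  simpa using this

lemma summable_weight_mul_zpow (N : ℤ) {α t : ℝ} (hα : 0 < α) (ht : 0 < t) :
    Summable fun n : ℕ => weight p N α t n * (p : ℝ) ^ (n - N : ℤ) := by
  have hpos := cast_prime_pos (p := p)
  refine Summable.of_nonneg_of_le (fun n => mul_nonneg (weight_nonneg N hα ht.le n)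
    (zpow_pos hpos _).le) (fun n => ?_) (summable_decay_mul_zpow (p := p) N hα ht)
  have := decay_nonneg (p := p) N α t (n + 1)
  gcongr
  rw [weight]
  linarith

/-- On the ball `B_N` the heat kernel of the ball is a nonnegative combination of normalized
indicators of balls; the weights come from Abel summation. -/
lemma ballHeatKernel_eq (N : ℤ) {α t : ℝ} (hα : 0 < α) (ht : 0 < t) {x : ℚ_[p]}
    (hx : x ∈ pBall p N) : ballHeatKernel p N α t x =
      ((∑' n : ℕ, weight p N α t n * dualBall p (n - N) x : ℝ) : ℂ) := by
  have hpos := cast_prime_pos (p := p)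
  have hx' : ‖x‖ ≤ (p : ℝ) ^ N := hx
  rw [ballHeatKernel, heatKernel_eq (-N) hα ht (by rwa [neg_neg]), cFun_eq N hα ht]
  have hd0 : dualBall p (((0 : ℕ) : ℤ) - N) x = (p : ℝ) ^ (-N) := by
    unfold dualBall
    rw [if_pos (by simpa using hx')]
    simp
  have hs1 : Summable fun n : ℕ => decay p N α t n * dualBall p (n - N) x :=
    Summable.of_nonneg_of_le (fun n => mul_nonneg (decay_nonneg _ _ _ _) (dualBall_nonneg _ _))
      (fun n => mul_le_mul_of_nonneg_left (dualBall_le _ _) (decay_nonneg _ _ _ _))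
      (summable_decay_mul_zpow N hα ht)
  have hs2 : Summable fun n : ℕ => decay p N α t (n + 1) * dualBall p (n - N) x :=
    Summable.of_nonneg_of_le (fun n => mul_nonneg (decay_nonneg _ _ _ _) (dualBall_nonneg _ _))
      (fun n => mul_le_mul_of_nonneg_right (antitone_decay N hα ht.le n.le_succ)
        (dualBall_nonneg _ _)) hs1
  have hs1' := (summable_nat_add_iff 1).2 hs1
  have hR : ∑' n : ℕ, weight p N α t n * dualBall p (n - N) x
      = (p : ℝ) ^ (-N) + ∑' n : ℕ, (decay p N α t (n + 1) *
        (dualBall p (n + 1 - N) x - dualBall p (n - N) x)) := by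
    simp_rw [weight, sub_mul, mul_sub]
    rw [hs1.tsum_sub hs2, hs1.tsum_eq_zero_add]
    push_cast at hs1' ⊢
    rw [hs1'.tsum_sub hs2]
    rw [decay_zero, one_mul]
    push_cast at hd0
    rw [hd0]
    ring
  rw [hR]
  simp_rw [decay_succ, mul_assoc]
  rw [tsum_mul_left]
  simp_rw [← sub_eq_add_neg]
  push_cast
  ring

end Kernel

/-! ### Semigroups diagonalized by an increasing family of projections -/

section Abstract

variable {E : Type*} [NormedAddCommGroup E] [NormedSpace ℂ E]

/-- The operator with eigenvalue `a 0` on the range of `e 0`, with eigenvalue `a j` on the range of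
`e j - e (j - 1)` for `1 ≤ j ≤ k`, and vanishing on the kernel of `e k`; it is written in the form
produced by Abel summation. -/
noncomputable def truncation (e : ℕ → E →L[ℂ] E) (a : ℕ → ℝ) (k : ℕ) : E →L[ℂ] E :=
  ∑ i ∈ Finset.range k, ((a i - a (i + 1) : ℝ) : ℂ) • e i + ((a k : ℝ) : ℂ) • e k

variable {e : ℕ → E →L[ℂ] E}

lemma truncation_succ (a : ℕ → ℝ) (k : ℕ) :
    truncation e a (k + 1) = truncation e a k + ((a (k + 1) : ℝ) : ℂ) • (e (k + 1) - e k) := by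
  rw [truncation, truncation, Finset.sum_range_succ, smul_sub]
  push_cast
  rw [sub_smul]
  abel

lemma truncation_one (k : ℕ) : truncation e (fun _ => 1) k = e k := by simp [truncation]

lemma truncation_mul (he : ∀ m n, e m * e n = e (min m n)) (a : ℕ → ℝ) {j k : ℕ} (h : k ≤ j) :
    truncation e a k * e j = truncation e a k := by
  rw [truncation, add_mul, Finset.sum_mul, smul_mul_assoc, he, min_eq_left h]
  congr 1
  refine Finset.sum_congr rfl fun i hi => ?_
  rw [smul_mul_assoc, he, min_eq_left ((Finset.mem_range.1 hi).le.trans h)]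

lemma mul_truncation (he : ∀ m n, e m * e n = e (min m n)) (a : ℕ → ℝ) {j k : ℕ} (h : k ≤ j) :
    e j * truncation e a k = truncation e a k := by
  rw [truncation, mul_add, Finset.mul_sum, mul_smul_comm, he, min_eq_right h]
  congr 1
  refine Finset.sum_congr rfl fun i hi => ?_
  rw [mul_smul_comm, he, min_eq_right ((Finset.mem_range.1 hi).le.trans h)]

lemma truncation_mul_truncation (he : ∀ m n, e m * e n = e (min m n)) (a b : ℕ → ℝ) (k : ℕ) :
    truncation e a k * truncation e b k = truncation e (fun n => a n * b n) k := by
  induction k with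
  | zero =>
    simp only [truncation, Finset.range_zero, Finset.sum_empty, zero_add]
    rw [smul_mul_smul_comm, he, min_self, Complex.ofReal_mul]
  | succ k ih =>
    have hD : (e (k + 1) - e k) * (e (k + 1) - e k) = e (k + 1) - e k := by
      simp [mul_sub, sub_mul, he]
    have h1 : truncation e a k * (e (k + 1) - e k) = 0 := by
      rw [mul_sub, truncation_mul he a k.le_succ, truncation_mul he a le_rfl, sub_self]
    have h2 : (e (k + 1) - e k) * truncation e b k = 0 := by
      rw [sub_mul, mul_truncation he b k.le_succ, mul_truncation he b le_rfl, sub_self]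
    rw [truncation_succ, truncation_succ, truncation_succ, add_mul, mul_add, mul_add,
      mul_smul_comm, h1, smul_mul_assoc, h2, smul_mul_smul_comm, hD, ih]
    push_cast
    simp

/-- For `a` decreasing to `0`, the operator with eigenvalue `a 0` on the range of `e 0` and `a j` on
the range of `e j - e (j - 1)`, as an absolutely convergent series of the projections `e n`. -/
noncomputable def diagonalOp (e : ℕ → E →L[ℂ] E) (a : ℕ → ℝ) : E →L[ℂ] E :=
  ∑' n, ((a n - a (n + 1) : ℝ) : ℂ) • e n

lemma norm_ofReal_smul_le (hn : ∀ n, ‖e n‖ ≤ 1) {c : ℝ} (hc : 0 ≤ c) (n : ℕ) :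
    ‖(c : ℂ) • e n‖ ≤ c := by
  rw [norm_smul, Complex.norm_real, Real.norm_of_nonneg hc]
  exact mul_le_of_le_one_right hc (hn n)

/-- In the product of `e k` with the series of `diagonalOp`, the tail `n ≥ k` telescopes to
`a k • e k`. -/
lemma hasSum_min {a : ℕ → ℝ} (k : ℕ)
    (hs : HasSum (fun n => a (n + k) - a (n + k + 1)) (a k)) :
    HasSum (fun n => ((a n - a (n + 1) : ℝ) : ℂ) • e (min k n)) (truncation e a k) := by
  rw [← hasSum_nat_add_iff' k]
  have e1 : truncation e a k - ∑ i ∈ Finset.range k, ((a i - a (i + 1) : ℝ) : ℂ) • e (min k i)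
      = ((a k : ℝ) : ℂ) • e k := by
    rw [truncation, sub_eq_iff_eq_add, add_comm]
    congr 1
    refine Finset.sum_congr rfl fun i hi => ?_
    rw [min_eq_right (Finset.mem_range.1 hi).le]
  rw [e1]
  have := (Complex.hasSum_ofReal.2 hs).smul_const (e k)
  refine this.congr_fun fun n => ?_
  rw [min_eq_left (Nat.le_add_left k n)]

lemma norm_diagonalOp_le (hn : ∀ n, ‖e n‖ ≤ 1) {a : ℕ → ℝ} (ha : Antitone a)
    (hs : HasSum (fun n => a n - a (n + 1)) 1) : ‖diagonalOp e a‖ ≤ 1 :=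
  tsum_of_norm_bounded hs fun n => norm_ofReal_smul_le hn (sub_nonneg.2 (ha n.le_succ)) n

variable [CompleteSpace E]

lemma hasSum_diagonalOp (hn : ∀ n, ‖e n‖ ≤ 1) {a : ℕ → ℝ} (ha : Antitone a)
    (hs : Summable fun n => a n - a (n + 1)) :
    HasSum (fun n => ((a n - a (n + 1) : ℝ) : ℂ) • e n) (diagonalOp e a) :=
  (Summable.of_norm_bounded hs fun n =>
    norm_ofReal_smul_le hn (sub_nonneg.2 (ha n.le_succ)) n).hasSum

lemma mul_diagonalOp (he : ∀ m n, e m * e n = e (min m n)) (hn : ∀ n, ‖e n‖ ≤ 1) {a : ℕ → ℝ}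
    (ha : Antitone a) (hs : ∀ k, HasSum (fun n => a (n + k) - a (n + k + 1)) (a k)) (k : ℕ) :
    e k * diagonalOp e a = truncation e a k := by
  have h := (hasSum_diagonalOp hn ha (by simpa using (hs 0).summable)).mul_left (e k)
  simp_rw [mul_smul_comm, he] at h
  exact h.unique (hasSum_min k (hs k))

lemma diagonalOp_mul (he : ∀ m n, e m * e n = e (min m n)) (hn : ∀ n, ‖e n‖ ≤ 1) {a : ℕ → ℝ}
    (ha : Antitone a) (hs : ∀ k, HasSum (fun n => a (n + k) - a (n + k + 1)) (a k)) (k : ℕ) :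
    diagonalOp e a * e k = truncation e a k := by
  have h := (hasSum_diagonalOp hn ha (by simpa using (hs 0).summable)).mul_right (e k)
  simp_rw [smul_mul_assoc, he, min_comm _ k] at h
  exact h.unique (hasSum_min k (hs k))

/-- Let `e n` be an increasing sequence of commuting contractive projections converging strongly
to the identity, and let the operators `T t` have eigenvalue `a t n` on the range of
`e n - e (n - 1)`, where `a t n` is multiplicative in `t` and decreases to `0` in `n`. Then `T` is a
contraction semigroup. At `t = 0` the defining series has vanishing weights, so the identity is
prescribed separately. -/
theorem isC0ContractionSemigroup_diagonalOp (he : ∀ m n, e m * e n = e (min m n))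
    (hn : ∀ n, ‖e n‖ ≤ 1) (hlim : ∀ f, Tendsto (fun n => e n f) atTop (𝓝 f))
    {a : ℝ≥0 → ℕ → ℝ} (ha : ∀ t, Antitone (a t)) (h0 : ∀ t, a t 0 = 1)
    (hs : ∀ t, 0 < t → ∀ k, HasSum (fun n => a t (n + k) - a t (n + k + 1)) (a t k))
    (ha0 : a 0 = fun _ => 1) (hadd : ∀ s t, a (s + t) = fun n => a s n * a t n)
    (hcont : ∀ n, Tendsto (fun t => a t n) (𝓝[>] 0) (𝓝 1)) :
    IsC0ContractionSemigroup fun t : ℝ≥0 =>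
      if t = 0 then ContinuousLinearMap.id ℂ E else diagonalOp e (a t) := by
  set T : ℝ≥0 → E →L[ℂ] E := fun t =>
    if t = 0 then ContinuousLinearMap.id ℂ E else diagonalOp e (a t) with hT
  have hleft (t : ℝ≥0) (k : ℕ) : e k * T t = truncation e (a t) k := by
    rcases eq_or_ne t 0 with rfl | ht
    · rw [ha0, truncation_one, hT]
      simp only [if_pos]
      exact mul_one _
    · simp only [hT, if_neg ht]
      exact mul_diagonalOp he hn (ha t) (hs t (pos_iff_ne_zero.2 ht)) k
  have hright (t : ℝ≥0) (k : ℕ) : T t * e k = truncation e (a t) k := by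
    rcases eq_or_ne t 0 with rfl | ht
    · rw [ha0, truncation_one, hT]
      simp only [if_pos]
      exact one_mul _
    · simp only [hT, if_neg ht]
      exact diagonalOp_mul he hn (ha t) (hs t (pos_iff_ne_zero.2 ht)) k
  have hcontr (t : ℝ≥0) : ‖T t‖ ≤ 1 := by
    rcases eq_or_ne t 0 with rfl | ht
    · simp only [hT, if_pos]
      exact ContinuousLinearMap.norm_id_le
    · simp only [hT, if_neg ht]
      have := hs t (pos_iff_ne_zero.2 ht) 0
      rw [h0] at this
      exact norm_diagonalOp_le hn (ha t) this
  refine ⟨by simp [hT], fun s t => ?_, fun f => ?_, hcontr⟩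
  · -- Both sides agree after composition with every `e k`, and `e k` tends to the identity.
    have hk (k : ℕ) : e k * T (s + t) = e k * (T s * T t) := by
      have hkk : e k = e k * e k := by rw [he, min_self]
      rw [hleft, hadd, ← truncation_mul_truncation he, ← hleft t, ← mul_assoc,
        truncation_mul he _ le_rfl, ← hleft, mul_assoc]
    ext f
    refine tendsto_nhds_unique (hlim (T (s + t) f)) ((hlim (T s (T t f))).congr fun k => ?_)
    exact (congrArg (fun S : E →L[ℂ] E => S f) (hk k)).symm
  · rw [Metric.tendsto_nhds]
    intro ε hε
    obtain ⟨k, hk⟩ := ((Metric.tendsto_nhds.1 (hlim f)) (ε / 3) (by positivity)).exists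
    have htr : Tendsto (fun t => truncation e (a t) k f) (𝓝[>] 0) (𝓝 (e k f)) := by
      have h1 : Tendsto (fun t => truncation e (a t) k) (𝓝[>] 0)
          (𝓝 (truncation e (fun _ => 1) k)) := by
        unfold truncation
        refine Tendsto.add (tendsto_finsetSum _ fun i _ => ?_) ?_
        · exact ((Complex.continuous_ofReal.tendsto _).comp
            ((hcont i).sub (hcont (i + 1)))).smul_const _
        · exact ((Complex.continuous_ofReal.tendsto _).comp (hcont k)).smul_const _
      rw [truncation_one] at h1
      exact ((ContinuousLinearMap.apply ℂ E f).continuous.tendsto _).comp h1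
    filter_upwards [(Metric.tendsto_nhds.1 htr) (ε / 3) (by positivity)] with t ht
    have hTe : T t (e k f) = truncation e (a t) k f :=
      congrArg (fun S : E →L[ℂ] E => S f) (hright t k)
    calc dist (T t f) f ≤ dist (T t f) (T t (e k f)) + dist (T t (e k f)) (e k f)
          + dist (e k f) f := dist_triangle4 _ _ _ _
      _ < ε / 3 + ε / 3 + ε / 3 := by
          gcongr
          · rw [dist_eq_norm, ← map_sub]
            refine ((T t).le_of_opNorm_le (hcontr t) _).trans_lt ?_
            rwa [one_mul, ← dist_eq_norm, dist_comm]
          · rwa [hTe]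
      _ = ε := by ring

end Abstract

/-! ### Averaging operators on the ball -/

section Averaging

variable {p : ℕ} [Fact p.Prime]

/-- Haar measure restricted to the ball `B_N`. -/
noncomputable abbrev ballMeasure (p : ℕ) [Fact p.Prime] (N : ℤ) : Measure ℚ_[p] :=
  (haar p).restrict (pBall p N)

lemma pBall_eq_closedBall (N : ℤ) : pBall p N = closedBall 0 ((p : ℝ) ^ N) := by
  ext x
  simp [pBall]

lemma measurableSet_pBall (N : ℤ) : MeasurableSet (pBall p N) := by
  rw [pBall_eq_closedBall]
  exact measurableSet_closedBall

instance (N : ℤ) : IsFiniteMeasure (ballMeasure p N) := by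
  refine ⟨?_⟩
  rw [Measure.restrict_apply_univ, pBall_eq_closedBall, haar_closedBall]
  exact ENNReal.ofReal_lt_top

lemma sub_mem_pBall {N : ℤ} {x y : ℚ_[p]} (hx : x ∈ pBall p N) (hy : y ∈ pBall p N) :
    x - y ∈ pBall p N := by
  have : ‖x + -y‖ ≤ max ‖x‖ ‖-y‖ := Padic.nonarchimedean x (-y)
  rw [norm_neg, ← sub_eq_add_neg] at this
  exact this.trans (max_le hx hy)

lemma ae_mem_pBall (N : ℤ) : ∀ᵐ x ∂(ballMeasure p N), x ∈ pBall p N :=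
  ae_restrict_mem (measurableSet_pBall N)

lemma dualBall_neg (k : ℤ) (x : ℚ_[p]) : dualBall p k (-x) = dualBall p k x := by
  simp [dualBall]

lemma dualBall_sub_comm (k : ℤ) (x y : ℚ_[p]) : dualBall p k (x - y) = dualBall p k (y - x) := by
  rw [← dualBall_neg, neg_sub]

lemma norm_le_of_dualBall_ne_zero {k : ℤ} {x : ℚ_[p]} (h : dualBall p k x ≠ 0) :
    ‖x‖ ≤ (p : ℝ) ^ (-k) := by
  by_contra hx
  exact h (if_neg hx)

lemma dualBall_add {k : ℤ} {h : ℚ_[p]} (hh : ‖h‖ ≤ (p : ℝ) ^ (-k)) (x : ℚ_[p]) :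
    dualBall p k (x + h) = dualBall p k x := by
  unfold dualBall
  congr 1
  apply propext
  constructor
  · intro hx
    have := Padic.nonarchimedean (x + h) (-h)
    rw [norm_neg, add_neg_cancel_right] at this
    exact this.trans (max_le hx hh)
  · intro hx
    exact (Padic.nonarchimedean x h).trans (max_le hx hh)

lemma continuous_dualBall (k : ℤ) : Continuous (dualBall p k) := by
  rw [continuous_iff_continuousAt]
  intro x
  apply ContinuousAt.congr (f := fun _ => dualBall p k x) continuousAt_const
  filter_upwards [closedBall_mem_nhds x (zpow_pos (cast_prime_pos (p := p)) (-k))] with y hy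
  rw [mem_closedBall, dist_eq_norm] at hy
  rw [← add_sub_cancel x y, dualBall_add hy]

lemma norm_dualBall_le (k : ℤ) (x : ℚ_[p]) : ‖(dualBall p k x : ℂ)‖ ≤ (p : ℝ) ^ k := by
  rw [Complex.norm_real, Real.norm_of_nonneg (dualBall_nonneg _ _)]
  exact dualBall_le _ _

lemma lintegral_dualBall (k : ℤ) (x : ℚ_[p]) :
    ∫⁻ y, ENNReal.ofReal (dualBall p k (x - y)) ∂(haar p) = 1 := by
  have hpos := cast_prime_pos (p := p)
  have e : (fun y => ENNReal.ofReal (dualBall p k (x - y)))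
      = (closedBall x ((p : ℝ) ^ (-k))).indicator fun _ => ENNReal.ofReal ((p : ℝ) ^ k) := by
    ext y
    by_cases hy : y ∈ closedBall x ((p : ℝ) ^ (-k))
    · rw [Set.indicator_of_mem hy]
      rw [mem_closedBall, dist_comm, dist_eq_norm] at hy
      rw [dualBall, if_pos hy]
    · rw [Set.indicator_of_notMem hy]
      rw [mem_closedBall, dist_comm, dist_eq_norm] at hy
      rw [dualBall, if_neg hy, ENNReal.ofReal_zero]
  rw [e, lintegral_indicator measurableSet_closedBall, setLIntegral_const, haar_closedBall,
    ← ENNReal.ofReal_mul (zpow_pos hpos _).le, ← zpow_add₀ hpos.ne']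
  simp

lemma lintegral_dualBall_le (N k : ℤ) (x : ℚ_[p]) :
    ∫⁻ y, ENNReal.ofReal (dualBall p k (x - y)) ∂(ballMeasure p N) ≤ 1 :=
  (setLIntegral_le_lintegral _ _).trans (lintegral_dualBall k x).le

lemma integrable_dualBall_mul (N k : ℤ) (x : ℚ_[p]) {f : ℚ_[p] → ℂ}
    (hf : Integrable f (ballMeasure p N)) :
    Integrable (fun y => (dualBall p k (x - y) : ℂ) * f y) (ballMeasure p N) := by
  refine hf.bdd_mul (c := (p : ℝ) ^ k) ?_ (.of_forall fun y => norm_dualBall_le _ _)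
  exact (Complex.continuous_ofReal.comp
    ((continuous_dualBall k).comp (continuous_const.sub continuous_id))).aestronglyMeasurable

lemma integrable_dualBall (N k : ℤ) (x : ℚ_[p]) :
    Integrable (fun y => (dualBall p k (x - y) : ℂ)) (ballMeasure p N) := by
  simpa using integrable_dualBall_mul N k x (f := fun _ => 1) (integrable_const _)

/-- The balls of radius `p ^ (N - n)` around points of `B_N` are contained in `B_N`. -/
lemma integral_dualBall (N : ℤ) (n : ℕ) {x : ℚ_[p]} (hx : x ∈ pBall p N) :
    ∫ y, dualBall p (n - N) (x - y) ∂(ballMeasure p N) = 1 := by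
  rw [setIntegral_eq_integral_of_forall_compl_eq_zero, integral_eq_lintegral_of_nonneg_ae,
    lintegral_dualBall, ENNReal.toReal_one]
  · exact .of_forall fun y => dualBall_nonneg _ _
  · exact ((continuous_dualBall _).comp
      (continuous_const.sub continuous_id)).aestronglyMeasurable
  · intro y hy
    by_contra h
    apply hy
    have h1 : x - y ∈ pBall p N := (norm_le_of_dualBall_ne_zero h).trans
      (zpow_le_zpow_right₀ one_lt_cast_prime.le (by omega))
    simpa using sub_mem_pBall hx h1

/-- The average of `f` over the ball of radius `p ^ (N - n)` around a point of `B_N`. -/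
noncomputable def average (N : ℤ) (n : ℕ) (f : ℚ_[p] → ℂ) (x : ℚ_[p]) : ℂ :=
  ∫ y, (dualBall p (n - N) (x - y) : ℂ) * f y ∂(ballMeasure p N)

lemma average_congr_ae {N : ℤ} {n : ℕ} {f g : ℚ_[p] → ℂ} (h : f =ᵐ[ballMeasure p N] g) :
    average N n f = average N n g := by
  ext x
  refine integral_congr_ae ?_
  filter_upwards [h] with y hy
  rw [hy]

/-- The average is locally constant. -/
lemma continuous_average (N : ℤ) (n : ℕ) (f : ℚ_[p] → ℂ) : Continuous (average N n f) := by
  rw [continuous_iff_continuousAt]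
  intro x
  apply ContinuousAt.congr (f := fun _ => average N n f x) continuousAt_const
  filter_upwards [closedBall_mem_nhds x (zpow_pos (cast_prime_pos (p := p)) (-(n - N : ℤ)))]
    with y hy
  rw [mem_closedBall, dist_eq_norm] at hy
  rw [average, average]
  congr 1
  ext z
  rw [← dualBall_add hy (x - z), show x - z + (y - x) = y - z by ring]

/-- Jensen's inequality for averages. -/
lemma enorm_average_rpow_le (N : ℤ) (n : ℕ) {q : ℝ≥0∞} (hq1 : 1 ≤ q) (hq : q ≠ ∞)
    {f : ℚ_[p] → ℂ} (hf : AEStronglyMeasurable f (ballMeasure p N)) (x : ℚ_[p]) :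
    ‖average N n f x‖ₑ ^ q.toReal ≤
      ∫⁻ y, ENNReal.ofReal (dualBall p (n - N) (x - y)) * ‖f y‖ₑ ^ q.toReal ∂(ballMeasure p N) := by
  have hq0 : 0 < q.toReal := ENNReal.toReal_pos (zero_lt_one.trans_le hq1).ne' hq
  have hq1' : 1 ≤ q.toReal := by
    rwa [← ENNReal.toReal_one, ENNReal.toReal_le_toReal ENNReal.one_ne_top hq]
  set K : ℚ_[p] → ℝ≥0∞ := fun y => ENNReal.ofReal (dualBall p (n - N) (x - y)) with hK
  have hKm : Measurable K := ENNReal.measurable_ofReal.comp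
    ((continuous_dualBall _).comp (continuous_const.sub continuous_id)).measurable
  set m := (ballMeasure p N).withDensity K with hm
  have hmass : m Set.univ ≤ 1 := by
    rw [hm, withDensity_apply _ MeasurableSet.univ, setLIntegral_univ]
    exact lintegral_dualBall_le N _ x
  have hfm : AEStronglyMeasurable f m :=
    hf.mono_ac (withDensity_absolutelyContinuous _ _)
  have h1 : ‖average N n f x‖ₑ ≤ eLpNorm f 1 m := by
    rw [eLpNorm_one_eq_lintegral_enorm, hm,
      lintegral_withDensity_eq_lintegral_mul₀ hKm.aemeasurable hf.enorm]
    refine (enorm_integral_le_lintegral_enorm _).trans (lintegral_mono fun y => ?_)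
    rw [enorm_mul, Pi.mul_apply, hK]
    gcongr
    rw [← ofReal_norm, Complex.norm_real, Real.norm_of_nonneg (dualBall_nonneg _ _)]
  have h2 : eLpNorm f 1 m ≤ eLpNorm f q m := by
    refine (eLpNorm_le_eLpNorm_mul_rpow_measure_univ hq1 hfm).trans ?_
    refine mul_le_of_le_one_right' (ENNReal.rpow_le_one hmass ?_)
    rw [ENNReal.toReal_one, sub_nonneg]
    simpa using inv_le_one_of_one_le₀ hq1'
  calc ‖average N n f x‖ₑ ^ q.toReal ≤ eLpNorm f q m ^ q.toReal := by
        gcongr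
        exact h1.trans h2
    _ = ∫⁻ y, ‖f y‖ₑ ^ q.toReal ∂m := by
        rw [eLpNorm_eq_lintegral_rpow_enorm_toReal (zero_lt_one.trans_le hq1).ne' hq,
          ← ENNReal.rpow_mul, one_div_mul_cancel hq0.ne', ENNReal.rpow_one]
    _ = _ := by
        rw [hm, lintegral_withDensity_eq_lintegral_mul₀ hKm.aemeasurable (hf.enorm.pow_const _)]
        rfl

lemma eLpNorm_average_le (N : ℤ) (n : ℕ) {q : ℝ≥0∞} (hq1 : 1 ≤ q) (hq : q ≠ ∞)
    {f : ℚ_[p] → ℂ} (hf : AEStronglyMeasurable f (ballMeasure p N)) :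
    eLpNorm (average N n f) q (ballMeasure p N) ≤ eLpNorm f q (ballMeasure p N) := by
  rw [eLpNorm_eq_lintegral_rpow_enorm_toReal (zero_lt_one.trans_le hq1).ne' hq,
    eLpNorm_eq_lintegral_rpow_enorm_toReal (zero_lt_one.trans_le hq1).ne' hq]
  gcongr ?_ ^ _
  have hKm : Measurable fun z : ℚ_[p] × ℚ_[p] =>
      ENNReal.ofReal (dualBall p (n - N) (z.1 - z.2)) :=
    ENNReal.measurable_ofReal.comp
      ((continuous_dualBall _).measurable.comp (measurable_fst.sub measurable_snd))
  have hg : AEMeasurable (fun z : ℚ_[p] × ℚ_[p] => ‖f z.2‖ₑ ^ q.toReal)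
      ((ballMeasure p N).prod (ballMeasure p N)) := hf.comp_snd.enorm.pow_const _
  have hKg : AEMeasurable (Function.uncurry fun x y : ℚ_[p] =>
      ENNReal.ofReal (dualBall p (n - N) (x - y)) * ‖f y‖ₑ ^ q.toReal)
      ((ballMeasure p N).prod (ballMeasure p N)) := hKm.aemeasurable.mul hg
  calc ∫⁻ x, ‖average N n f x‖ₑ ^ q.toReal ∂(ballMeasure p N)
      ≤ ∫⁻ x, ∫⁻ y, ENNReal.ofReal (dualBall p (n - N) (x - y)) * ‖f y‖ₑ ^ q.toReal
          ∂(ballMeasure p N) ∂(ballMeasure p N) :=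
        lintegral_mono fun x => enorm_average_rpow_le N n hq1 hq hf x
    _ = ∫⁻ y, ∫⁻ x, ENNReal.ofReal (dualBall p (n - N) (x - y)) * ‖f y‖ₑ ^ q.toReal
          ∂(ballMeasure p N) ∂(ballMeasure p N) :=
        lintegral_lintegral_swap hKg
    _ ≤ ∫⁻ y, ‖f y‖ₑ ^ q.toReal ∂(ballMeasure p N) := by
        refine lintegral_mono fun y => ?_
        simp_rw [dualBall_sub_comm _ _ y]
        rw [lintegral_mul_const]
        · exact mul_le_of_le_one_left' (lintegral_dualBall_le N _ y)
        · exact ENNReal.measurable_ofReal.comp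
            ((continuous_dualBall _).comp (continuous_const.sub continuous_id)).measurable

/-- The kernels of the averages over balls of two radii compose to the kernel of the average over
balls of the larger radius. -/
lemma integral_dualBall_mul_dualBall (N : ℤ) (m n : ℕ) {x z : ℚ_[p]} (hx : x ∈ pBall p N)
    (hz : z ∈ pBall p N) :
    ∫ y, dualBall p (m - N) (x - y) * dualBall p (n - N) (y - z) ∂(ballMeasure p N)
      = dualBall p ((min m n : ℕ) - N) (x - z) := by
  wlog h : m ≤ n generalizing m n x z
  · have := this n m hz hx (by omega)
    rw [min_comm, dualBall_sub_comm, ← this]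
    congr 1
    ext y
    rw [mul_comm, dualBall_sub_comm _ y z, dualBall_sub_comm _ x y]
  · rw [min_eq_left h]
    have e (y : ℚ_[p]) : dualBall p (m - N) (x - y) * dualBall p (n - N) (y - z)
        = dualBall p (m - N) (x - z) * dualBall p (n - N) (z - y) := by
      rw [dualBall_sub_comm (n - N) y z]
      by_cases h0 : dualBall p (n - N) (z - y) = 0
      · rw [h0, mul_zero, mul_zero]
      · have h1 : ‖z - y‖ ≤ (p : ℝ) ^ (-(m - N : ℤ)) := (norm_le_of_dualBall_ne_zero h0).trans
          (zpow_le_zpow_right₀ one_lt_cast_prime.le (by omega))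
        rw [← dualBall_add h1 (x - z), sub_add_sub_cancel]
    simp_rw [e]
    rw [integral_const_mul, integral_dualBall N n hz, mul_one]

lemma average_average (N : ℤ) (m n : ℕ) {f : ℚ_[p] → ℂ} (hf : Integrable f (ballMeasure p N))
    {x : ℚ_[p]} (hx : x ∈ pBall p N) :
    average N m (average N n f) x = average N (min m n) f x := by
  simp only [average]
  simp_rw [← integral_const_mul]
  rw [integral_integral_swap]
  · refine integral_congr_ae ?_
    filter_upwards [ae_mem_pBall N] with z hz
    rw [← integral_dualBall_mul_dualBall N m n hx hz, ← integral_complex_ofReal,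
      ← integral_mul_const]
    congr 1
    ext y
    push_cast
    ring
  · have e : (Function.uncurry fun y z => (dualBall p (m - N) (x - y) : ℂ) *
        ((dualBall p (n - N) (y - z) : ℂ) * f z))
        = fun w : ℚ_[p] × ℚ_[p] => ((dualBall p (m - N) (x - w.1) * dualBall p (n - N) (w.1 - w.2) :
          ℝ) : ℂ) * f w.2 := by
      ext w
      simp only [Function.uncurry]
      push_cast
      ring
    rw [e]
    refine (hf.comp_snd (ballMeasure p N)).bdd_mul
      (c := (p : ℝ) ^ (m - N : ℤ) * (p : ℝ) ^ (n - N : ℤ)) ?_ (.of_forall fun w => ?_)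
    · have h1 : Measurable fun w : ℚ_[p] × ℚ_[p] =>
          dualBall p (m - N) (x - w.1) * dualBall p (n - N) (w.1 - w.2) :=
        ((continuous_dualBall _).measurable.comp (measurable_const.sub measurable_fst)).mul
          ((continuous_dualBall _).measurable.comp (measurable_fst.sub measurable_snd))
      exact (Complex.measurable_ofReal.comp h1).aestronglyMeasurable
    · push_cast
      rw [norm_mul]
      exact mul_le_mul (norm_dualBall_le _ _) (norm_dualBall_le _ _) (norm_nonneg _)
        (zpow_pos cast_prime_pos _).le

lemma norm_average_sub_le {N : ℤ} {n : ℕ} {f : ℚ_[p] → ℂ} (hf : Integrable f (ballMeasure p N))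
    {x : ℚ_[p]} (hx : x ∈ pBall p N) {ε : ℝ}
    (h : ∀ y ∈ pBall p N, ‖x - y‖ ≤ (p : ℝ) ^ (N - n : ℤ) → ‖f y - f x‖ ≤ ε) :
    ‖average N n f x - f x‖ ≤ ε := by
  have h1 : f x = ∫ y, (dualBall p (n - N) (x - y) : ℂ) * f x ∂(ballMeasure p N) := by
    rw [integral_mul_const, integral_complex_ofReal, integral_dualBall N n hx]
    simp
  have h2 : average N n f x - f x
      = ∫ y, (dualBall p (n - N) (x - y) : ℂ) * (f y - f x) ∂(ballMeasure p N) := by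
    conv_lhs => rw [h1]
    rw [average, ← integral_sub (integrable_dualBall_mul N _ x hf)
      (integrable_dualBall_mul N _ x (integrable_const _))]
    simp_rw [mul_sub]
  rw [h2]
  have hre : Integrable (fun y => dualBall p (n - N) (x - y)) (ballMeasure p N) := by
    simpa using (integrable_dualBall N (n - N) x).re
  calc _ ≤ ∫ y, dualBall p (n - N) (x - y) * ε ∂(ballMeasure p N) := by
        refine norm_integral_le_of_norm_le (hre.mul_const ε) ?_
        filter_upwards [ae_mem_pBall N] with y hy
        rw [norm_mul, Complex.norm_real, Real.norm_of_nonneg (dualBall_nonneg _ _)]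
        by_cases h0 : dualBall p (n - N) (x - y) = 0
        · simp [h0]
        · have h3 := norm_le_of_dualBall_ne_zero h0
          rw [neg_sub] at h3
          exact mul_le_mul_of_nonneg_left (h y hy h3) (dualBall_nonneg _ _)
    _ = ε := by rw [integral_mul_const, integral_dualBall N n hx, one_mul]

variable {q : ℝ≥0∞} [hq1 : Fact (1 ≤ q)]

lemma integrable_Lq {N : ℤ} (f : LqBall p N q) : Integrable f (ballMeasure p N) :=
  (Lp.memLp f).integrable hq1.out

lemma memLp_average (hq : q ≠ ∞) (N : ℤ) (n : ℕ) (f : LqBall p N q) :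
    MemLp (average N n f) q (ballMeasure p N) :=
  ⟨(continuous_average N n f).aestronglyMeasurable,
    (eLpNorm_average_le N n hq1.out hq (Lp.aestronglyMeasurable f)).trans_lt (Lp.eLpNorm_lt_top f)⟩

/-- Averaging over balls of radius `p ^ (N - n)`, as a contraction of `L^q(B_N)`. -/
noncomputable def averageOp (hq : q ≠ ∞) (N : ℤ) (n : ℕ) : LqBall p N q →L[ℂ] LqBall p N q :=
  LinearMap.mkContinuous
    { toFun := fun f => (memLp_average hq N n f).toLp
      map_add' := fun f g => by
        rw [← MemLp.toLp_add, MemLp.toLp_eq_toLp_iff]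
        refine .of_forall fun x => ?_
        rw [average_congr_ae (Lp.coeFn_add f g), Pi.add_apply, average, average, average,
          ← integral_add (integrable_dualBall_mul N _ x (integrable_Lq f))
            (integrable_dualBall_mul N _ x (integrable_Lq g))]
        simp_rw [Pi.add_apply, mul_add]
      map_smul' := fun c f => by
        rw [RingHom.id_apply, ← MemLp.toLp_const_smul, MemLp.toLp_eq_toLp_iff]
        refine .of_forall fun x => ?_
        rw [average_congr_ae (Lp.coeFn_smul c f), Pi.smul_apply, average, average, smul_eq_mul,
          ← integral_const_mul]
        congr 1
        ext y
        rw [Pi.smul_apply, smul_eq_mul, mul_left_comm] }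
    1 fun f => by
      rw [one_mul]
      change ‖(memLp_average hq N n f).toLp‖ ≤ ‖f‖
      rw [Lp.norm_toLp, Lp.norm_def]
      exact ENNReal.toReal_mono (Lp.eLpNorm_ne_top f)
        (eLpNorm_average_le N n hq1.out hq (Lp.aestronglyMeasurable f))

lemma averageOp_ae_eq (hq : q ≠ ∞) (N : ℤ) (n : ℕ) (f : LqBall p N q) :
    averageOp hq N n f =ᵐ[ballMeasure p N] average N n f :=
  MemLp.coeFn_toLp (memLp_average hq N n f)

lemma norm_averageOp_le (hq : q ≠ ∞) (N : ℤ) (n : ℕ) :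
    ‖(averageOp hq N n : LqBall p N q →L[ℂ] LqBall p N q)‖ ≤ 1 :=
  LinearMap.mkContinuous_norm_le _ zero_le_one _

lemma averageOp_mul (hq : q ≠ ∞) (N : ℤ) (m n : ℕ) :
    (averageOp hq N m * averageOp hq N n : LqBall p N q →L[ℂ] LqBall p N q)
      = averageOp hq N (min m n) := by
  ext1 f
  apply Lp.ext
  refine (averageOp_ae_eq hq N m (averageOp hq N n f)).trans
    (EventuallyEq.trans ?_ (averageOp_ae_eq hq N (min m n) f).symm)
  rw [average_congr_ae (averageOp_ae_eq hq N n f)]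
  filter_upwards [ae_mem_pBall N] with x hx
  exact average_average N m n (integrable_Lq f) hx

/-- Averages over small balls converge: uniformly for a continuous function, hence in norm for every
`f` by density. -/
lemma tendsto_averageOp (hq : q ≠ ∞) (N : ℤ) (f : LqBall p N q) :
    Tendsto (fun n => averageOp hq N n f) atTop (𝓝 f) := by
  have hpos := cast_prime_pos (p := p)
  have hcont (g : BoundedContinuousFunction ℚ_[p] ℂ) :
      Tendsto (fun n => averageOp hq N n (g.toLp q (ballMeasure p N) ℂ)) atTop
        (𝓝 (g.toLp q (ballMeasure p N) ℂ)) := by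
    set G : LqBall p N q := g.toLp q (ballMeasure p N) ℂ with hG
    have hGg : G =ᵐ[ballMeasure p N] g := BoundedContinuousFunction.coeFn_toLp _ _ ℂ g
    have huc : UniformContinuousOn g (pBall p N) := by
      rw [pBall_eq_closedBall]
      exact (isCompact_closedBall _ _).uniformContinuousOn_of_continuous g.continuous.continuousOn
    have hgi : Integrable g (ballMeasure p N) := (integrable_Lq G).congr hGg
    set C : ℝ := (measureUnivNNReal (ballMeasure p N) : ℝ) ^ q.toReal⁻¹ with hC
    have hC0 : 0 ≤ C := by positivity
    rw [Metric.tendsto_nhds]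
    intro ε hε
    rw [Metric.uniformContinuousOn_iff] at huc
    obtain ⟨δ, hδ, hgδ⟩ := huc (ε / (C + 1)) (by positivity)
    have hr : Tendsto (fun n : ℕ => (p : ℝ) ^ (N - n : ℤ)) atTop (𝓝 0) := by
      have e (n : ℕ) : (p : ℝ) ^ (N - n : ℤ) = (p : ℝ) ^ N * ((p : ℝ)⁻¹) ^ n := by
        rw [zpow_sub₀ hpos.ne', zpow_natCast, inv_pow, div_eq_mul_inv]
      simp_rw [e]
      simpa using (tendsto_pow_atTop_nhds_zero_of_lt_one (inv_nonneg.2 hpos.le)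
        (inv_lt_one_of_one_lt₀ one_lt_cast_prime)).const_mul ((p : ℝ) ^ N)
    filter_upwards [hr.eventually_lt_const hδ] with n hn
    rw [dist_eq_norm]
    have hb : ‖averageOp hq N n G - G‖ ≤ C * (ε / (C + 1)) := by
      refine Lp.norm_le_of_ae_bound (by positivity) ?_
      filter_upwards [Lp.coeFn_sub (averageOp hq N n G) G, averageOp_ae_eq hq N n G, hGg,
        ae_mem_pBall N] with x h1 h2 h3 hx
      rw [h1, Pi.sub_apply, h2, h3, average_congr_ae hGg]
      refine norm_average_sub_le hgi hx fun y hy hxy => ?_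
      rw [← dist_eq_norm]
      refine (hgδ y hy x hx ?_).le
      rw [dist_comm, dist_eq_norm]
      exact hxy.trans_lt hn
    refine hb.trans_lt ?_
    rw [mul_div_assoc', div_lt_iff₀ (by positivity)]
    nlinarith
  have hdense := BoundedContinuousFunction.toLp_denseRange ℂ (ballMeasure p N) ℂ hq
  rw [Metric.tendsto_nhds]
  intro ε hε
  obtain ⟨g, hg⟩ := hdense.exists_dist_lt f (ε := ε / 3) (by positivity)
  set G : LqBall p N q := g.toLp q (ballMeasure p N) ℂ with hG
  filter_upwards [Metric.tendsto_nhds.1 (hcont g) (ε / 3) (by positivity)] with n hn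
  calc dist (averageOp hq N n f) f
      ≤ dist (averageOp hq N n f) (averageOp hq N n G) + dist (averageOp hq N n G) G
        + dist G f := dist_triangle4 _ _ _ _
    _ < ε / 3 + ε / 3 + ε / 3 := by
        gcongr
        · rw [dist_eq_norm, ← map_sub]
          refine (ContinuousLinearMap.le_of_opNorm_le _ (norm_averageOp_le hq N n) _).trans_lt ?_
          rwa [one_mul, ← dist_eq_norm]
        · rwa [dist_comm]
    _ = ε := by ring

end Averaging

/-! ### The semigroup -/

section Semigroup

variable {p : ℕ} [Fact p.Prime]

/-- The series of the weighted averages of `f` converges to the integral of `f` against the heat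
kernel. -/
lemma hasSum_weight_mul_average (N : ℤ) {α t : ℝ} (hα : 0 < α) (ht : 0 < t) {f : ℚ_[p] → ℂ}
    (hf : Integrable f (ballMeasure p N)) {x : ℚ_[p]} (hx : x ∈ pBall p N) :
    IntegrableOn (fun y => ballHeatKernel p N α t (x - y) * f y) (pBall p N) (haar p) ∧
    HasSum (fun n => (weight p N α t n : ℂ) * average N n f x)
      (∫ y in pBall p N, ballHeatKernel p N α t (x - y) * f y ∂(haar p)) := by
  set F : ℕ → ℚ_[p] → ℂ := fun n y =>
    (weight p N α t n : ℂ) * ((dualBall p (n - N) (x - y) : ℂ) * f y) with hF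
  have hFi (n : ℕ) : Integrable (F n) (ballMeasure p N) :=
    (integrable_dualBall_mul N _ x hf).const_mul _
  have hFn (n : ℕ) (y : ℚ_[p]) : ‖F n y‖ ≤ weight p N α t n * (p : ℝ) ^ (n - N : ℤ) * ‖f y‖ := by
    have hw := weight_nonneg (p := p) N hα ht.le n
    rw [hF]
    simp only [norm_mul]
    rw [Complex.norm_real, Real.norm_of_nonneg hw, ← mul_assoc]
    gcongr
    exact norm_dualBall_le _ _
  have hFsum : Summable fun n => ∫ y, ‖F n y‖ ∂(ballMeasure p N) := by
    refine Summable.of_nonneg_of_le (fun n => integral_nonneg fun _ => norm_nonneg _) (fun n => ?_)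
      ((summable_weight_mul_zpow (p := p) N hα ht).mul_right (∫ y, ‖f y‖ ∂(ballMeasure p N)))
    rw [← integral_const_mul]
    exact integral_mono (hFi n).norm (hf.norm.const_mul _) (hFn n)
  have hker : (fun y => ∑' n, F n y) =ᵐ[ballMeasure p N]
      fun y => ballHeatKernel p N α t (x - y) * f y := by
    filter_upwards [ae_mem_pBall N] with y hy
    rw [ballHeatKernel_eq N hα ht (sub_mem_pBall hx hy), Complex.ofReal_tsum, ← tsum_mul_right]
    congr 1
    ext n
    rw [hF]
    push_cast
    ring
  constructor
  · -- The integrand is a pointwise limit of partial sums, dominated by a multiple of `‖f‖`.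
    have hmeas : AEStronglyMeasurable (fun y => ∑' n, F n y) (ballMeasure p N) := by
      have h1 : ∀ y, HasSum (fun n => F n y) (∑' n, F n y) := fun y =>
        (Summable.of_norm_bounded ((summable_weight_mul_zpow (p := p) N hα ht).mul_right ‖f y‖)
          fun n => hFn n y).hasSum
      refine aestronglyMeasurable_of_tendsto_ae atTop
        (f := fun m y => ∑ n ∈ Finset.range m, F n y) (fun m => ?_)
        (.of_forall fun y => (h1 y).tendsto_sum_nat)
      exact Finset.aestronglyMeasurable_fun_sum _ fun n _ => (hFi n).aestronglyMeasurable
    refine Integrable.congr (f := fun y => ∑' n, F n y) ?_ hker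
    refine (hf.norm.const_mul (∑' n, weight p N α t n * (p : ℝ) ^ (n - N : ℤ))).mono' hmeas
      (.of_forall fun y => ?_)
    exact tsum_of_norm_bounded ((summable_weight_mul_zpow (p := p) N hα ht).hasSum.mul_right ‖f y‖)
      fun n => hFn n y
  · have h := hasSum_integral_of_summable_integral_norm hFi hFsum
    rw [integral_congr_ae hker] at h
    refine h.congr_fun fun n => ?_
    rw [average, ← integral_const_mul]

variable {q : ℝ≥0∞} [hq1 : Fact (1 ≤ q)]

/-- The diagonal operator with eigenvalues `decay p N α t` is integration against the heat
kernel. -/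
lemma diagonalOp_averageOp_ae_eq (hq : q ≠ ∞) (N : ℤ) {α t : ℝ} (hα : 0 < α) (ht : 0 < t)
    (f : LqBall p N q) :
    diagonalOp (averageOp hq N) (decay p N α t) f =ᵐ[ballMeasure p N]
      fun x => ∫ y in pBall p N, ballHeatKernel p N α t (x - y) * f y ∂(haar p) := by
  have h := hasSum_diagonalOp (norm_averageOp_le (p := p) (q := q) hq N)
    (antitone_decay N hα ht.le)
    (by simpa [weight] using (hasSum_weight_add (p := p) N hα ht 0).summable)
  have hf : HasSum (fun n => (weight p N α t n : ℂ) • averageOp hq N n f)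
      (diagonalOp (averageOp hq N) (decay p N α t) f) :=
    h.mapL (ContinuousLinearMap.apply ℂ _ f)
  -- Convergence in `L^q` gives pointwise convergence along a subsequence.
  obtain ⟨ns, hns, hlim⟩ :=
    (tendstoInMeasure_of_tendsto_Lp hf.tendsto_sum_nat).exists_seq_tendsto_ae
  have hpart : ∀ᵐ x ∂(ballMeasure p N), ∀ m,
      (∑ n ∈ Finset.range m, (weight p N α t n : ℂ) • averageOp hq N n f : LqBall p N q) x
        = ∑ n ∈ Finset.range m, (weight p N α t n : ℂ) * average N n f x := by
    rw [ae_all_iff]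
    intro m
    induction m with
    | zero =>
      filter_upwards [Lp.coeFn_zero ℂ q (ballMeasure p N)] with x hx
      simpa using hx
    | succ m ih =>
      rw [Finset.sum_range_succ]
      filter_upwards [ih, Lp.coeFn_add (∑ n ∈ Finset.range m, (weight p N α t n : ℂ) •
          averageOp hq N n f) ((weight p N α t m : ℂ) • averageOp hq N m f),
        Lp.coeFn_smul (weight p N α t m : ℂ) (averageOp hq N m f),
        averageOp_ae_eq hq N m f] with x h1 h2 h3 h4
      rw [h2, Pi.add_apply, h1, h3, Pi.smul_apply, h4, smul_eq_mul, Finset.sum_range_succ]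
  filter_upwards [hlim, hpart, ae_mem_pBall N] with x h1 h2 hx
  simp_rw [h2] at h1
  exact tendsto_nhds_unique h1
    (((hasSum_weight_mul_average N hα ht (integrable_Lq f) hx).2.tendsto_sum_nat).comp
      hns.tendsto_atTop)

end Semigroup

end PadicHeat

theorem proposition1 (p : ℕ) [Fact p.Prime] (N : ℤ) (α : ℝ) (hα : 0 < α)
    (q : ℝ≥0∞) [Fact (1 ≤ q)] (hq : q ≠ ∞) :
    ∃ T : ℝ≥0 → (PadicHeat.LqBall p N q →L[ℂ] PadicHeat.LqBall p N q),
      (∀ t : ℝ≥0, 0 < t → ∀ ψ : PadicHeat.LqBall p N q,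
        (∀ x ∈ PadicHeat.pBall p N,
          IntegrableOn (fun y => PadicHeat.ballHeatKernel p N α t (x - y) * ψ y)
            (PadicHeat.pBall p N) (PadicHeat.haar p)) ∧
        ∀ᵐ x ∂((PadicHeat.haar p).restrict (PadicHeat.pBall p N)),
          T t ψ x = ∫ y in PadicHeat.pBall p N,
            PadicHeat.ballHeatKernel p N α t (x - y) * ψ y ∂(PadicHeat.haar p)) ∧
      PadicHeat.IsC0ContractionSemigroup T := by
  refine ⟨fun t => if t = 0 then ContinuousLinearMap.id ℂ _ else
    PadicHeat.diagonalOp (PadicHeat.averageOp hq N) (PadicHeat.decay p N α t),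
    fun t ht ψ => ⟨fun x hx => ?_, ?_⟩, ?_⟩
  · exact (PadicHeat.hasSum_weight_mul_average N hα (NNReal.coe_pos.2 ht)
      (PadicHeat.integrable_Lq ψ) hx).1
  · simp only [if_neg ht.ne']
    exact PadicHeat.diagonalOp_averageOp_ae_eq hq N hα (NNReal.coe_pos.2 ht) ψ
  · refine PadicHeat.isC0ContractionSemigroup_diagonalOp
      (a := fun t : ℝ≥0 => PadicHeat.decay p N α t) (PadicHeat.averageOp_mul hq N)
      (PadicHeat.norm_averageOp_le hq N) (PadicHeat.tendsto_averageOp hq N)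
      (fun t => PadicHeat.antitone_decay N hα t.2) (fun t => PadicHeat.decay_zero N α t)
      (fun t ht k => PadicHeat.hasSum_weight_add N hα (NNReal.coe_pos.2 ht) k) ?_ ?_ ?_
    · ext n
      simp [PadicHeat.decay]
    · intro s t
      ext n
      exact PadicHeat.decay_add N α s t n
    · intro n
      have h : Continuous fun t : ℝ≥0 => PadicHeat.decay p N α t n := by
        unfold PadicHeat.decay
        fun_prop
      have h0 := h.tendsto 0
      simp only [PadicHeat.decay, NNReal.coe_zero, neg_zero, zero_mul, Real.exp_zero] at h0
      exact h0.mono_left nhdsWithin_le_nhds
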